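/- Let $\rho$ be a probability measure on a measurable space $\mathcal Z$, let $\Omega\subseteq\mathbb R^d$ be nonempty, closed and convex, and let $f:\mathbb R^d\times\mathcal Z\to\mathbb R$ be a loss such that $z\mapsto f(w;z)$ is measurable and $\rho$-integrable for every $w$, and such that for every $z$ the function $w\mapsto f(w;z)$ is nonnegative, convex and $L$-smooth on $\mathbb R^d$ (differentiable with $L$-Lipschitz gradient), where $L>0$. Put $F(w)=\mathbb E_{z\sim\rho}[f(w;z)]$ and let $w^*\in\arg\min_{w\in\Omega}F(w)$. Let $S=(z_1,\dots,z_n)$, $n\ge 1$, be an i.i.d. sample from $\rho$. Projected SGD starts at $w_1=0$ and iterates $$w_{t+1}=\Pi_\Omega\big(w_t-\eta_t\nabla f(w_t;z_{i_t})\big),$$ where $\Pi_\Omega$ is the Euclidean projection on $\Omega$, $\nabla$ is the gradient in $w$, and $i_1,i_2,\dots$ are i.i.d. uniform on $\{1,\dots,n\}$, independent of $S$. Let $\bar w_T=\big(\sum_{t=1}^T\eta_tw_t\big)/\sum_{t=1}^T\eta_t$, and let $\mathbb E_{S,A}$ denote the expectation over $S$ and over the indices. Write $T\asymp n$ if $aT\le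 n\le bT$ with constants $a,b>0$. (a) If $\eta_t=c/\sqrt T\le 1/(2L)$ for all $t$, with a constant $c>0$, and $T\asymp n$, then $F(\bar w_T)$ is integrable and $$\mathbb E_{S,A}[F(\bar w_T)]-F(w^*)=O\Big(\frac{F(w^*)+1}{\sqrt n}\Big),$$ where the constant in $O(\cdot)$ depends only on $L$, $c$, $a$, $b$ and an upper bound $R$ on $\|w^*\|_2$. (b) If $\eta_t=\eta_1$ for all $t$, with a constant $0<\eta_1\le 1/(2L)$, if $F(w^*)=0$ and $T\asymp n$, then $F(\bar w_T)$ is integrable and $$\mathbb E_{S,A}[F(\bar w_T)]-F(w^*)=O(1/n),$$ where the constant in $O(\cdot)$ depends only on $L$, $\eta_1$, $a$, $b$ and an upper bound $R$ on $\|w^*\|_2$. -/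

import Mathlib

open MeasureTheory ProbabilityTheory

noncomputable section

/-- The parameter space `ℝ^d` with its Euclidean norm. -/
abbrev Param (d : ℕ) : Type := EuclideanSpace ℝ (Fin d)

/-- The loss `f(w; z)` is, for every `z`, a nonnegative, convex and `L`-smooth function of
`w ∈ ℝ^d`; `L`-smooth means differentiable with an `L`-Lipschitz gradient. -/
structure IsSmoothConvexLoss {d : ℕ} {Z : Type*} (L : ℝ) (f : Param d → Z → ℝ) : Prop where
  nonneg : ∀ w z, 0 ≤ f w z
  convex : ∀ z, ConvexOn ℝ Set.univ (fun w => f w z)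
  differentiable : ∀ z, Differentiable ℝ (fun w => f w z)
  smooth : ∀ z w w', ‖gradient (fun u => f u z) w - gradient (fun u => f u z) w'‖ ≤ L * ‖w - w'‖

/-- The population risk `F(w) = 𝔼_z f(w; z)`. -/
def popRisk {d : ℕ} {Z : Type*} [MeasurableSpace Z] (ρ : Measure Z) (f : Param d → Z → ℝ)
    (w : Param d) : ℝ :=
  ∫ z, f w z ∂ρ

/-- The Euclidean projection of `x` on `Ω`: the point of `Ω` nearest to `x`
(it exists and is unique when `Ω` is nonempty, closed and convex). -/
def projOn {d : ℕ} (Ω : Set (Param d)) (x : Param d) : Param d :=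
  Classical.epsilon fun y => y ∈ Ω ∧ dist x y = Metric.infDist x Ω

/-- For `Ω` nonempty, closed and convex, `projOn Ω x` is the unique nearest point of `Ω`. -/
theorem projOn_spec {d : ℕ} {Ω : Set (Param d)} (hne : Ω.Nonempty) (hcl : IsClosed Ω)
    (hcv : Convex ℝ Ω) (x : Param d) :
    (projOn Ω x ∈ Ω ∧ dist x (projOn Ω x) = Metric.infDist x Ω) ∧
      ∀ y ∈ Ω, dist x y = Metric.infDist x Ω → y = projOn Ω x := by
  have hex : ∃ y, y ∈ Ω ∧ dist x y = Metric.infDist x Ω := by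
    obtain ⟨y, hy, h⟩ := hcl.exists_infDist_eq_dist hne x
    exact ⟨y, hy, h.symm⟩
  have hp : projOn Ω x ∈ Ω ∧ dist x (projOn Ω x) = Metric.infDist x Ω :=
    Classical.epsilon_spec hex
  have key : ∀ y ∈ Ω, dist x y = Metric.infDist x Ω → ∀ u ∈ Ω, inner ℝ (x - y) (u - y) ≤ 0 := by
    intro y hy hd
    refine (norm_eq_iInf_iff_real_inner_le_zero hcv hy).1 ?_
    rw [← dist_eq_norm, hd, Metric.infDist_eq_iInf]
    simp only [dist_eq_norm]
  refine ⟨hp, fun y hy hd => ?_⟩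
  have h1 := key y hy hd _ hp.1
  have h2 := key _ hp.1 hp.2 y hy
  set q := projOn Ω x
  have h3 : inner ℝ (y - q) (y - q) ≤ (0 : ℝ) := by
    have e : inner ℝ (y - q) (y - q) = inner ℝ (x - y) (q - y) + inner ℝ (x - q) (y - q) := by
      rw [← neg_sub y q, inner_neg_right, ← sub_eq_neg_add, ← inner_sub_left]
      congr 1
      abel
    linarith
  exact sub_eq_zero.1 (real_inner_self_nonpos.1 h3)

/-- The iterates of projected SGD on the sample `S = (z_1, …, z_n)` along the drawn indices `i`.
Everything is indexed from `0`: `sgd Ω f η S i t` is the `(t+1)`-st iterate, so that the value at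
`0` is the initial point `w_1 = 0`, and `η t`, `i t` are the `(t+1)`-st step size and index. -/
def sgd {d n : ℕ} {Z : Type*} (Ω : Set (Param d)) (f : Param d → Z → ℝ) (η : ℕ → ℝ)
    (S : Fin n → Z) (i : ℕ → Fin n) : ℕ → Param d
  | 0 => 0
  | t + 1 =>
      projOn Ω (sgd Ω f η S i t - η t • gradient (fun u => f u (S (i t))) (sgd Ω f η S i t))

/-- The weighted average `(∑_{t ≤ T} η_t w_t) / ∑_{t ≤ T} η_t` of the first `T` iterates. -/
def sgdAverage {d n : ℕ} {Z : Type*} (Ω : Set (Param d)) (f : Param d → Z → ℝ) (η : ℕ → ℝ)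
    (S : Fin n → Z) (i : ℕ → Fin n) (T : ℕ) : Param d :=
  (∑ t ∈ Finset.range T, η t)⁻¹ • ∑ t ∈ Finset.range T, η t • sgd Ω f η S i t

/-- The joint law of the sample and of the drawn indices: `z_1, …, z_n` are i.i.d. with law `ρ`,
the indices are i.i.d. uniform on the `n` sample positions, and the two are independent. -/
def sampleIndexLaw {Z : Type*} [MeasurableSpace Z] (ρ : Measure Z) (n : ℕ) [NeZero n] :
    Measure ((Fin n → Z) × (ℕ → Fin n)) :=
  (Measure.pi fun _ : Fin n => ρ).prod
    (Measure.infinitePi fun _ : ℕ => (PMF.uniformOfFintype (Fin n)).toMeasure)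

end

/-! The proof combines algorithmic stability on average with the optimization bound for SGD, and
smoothness together with nonnegativity lets both be controlled by the same quantity, the training
loss along the path.

Generalization: replace `z_k` by an independent copy. By symmetry, the expected risk of the average
equals the expected loss at the old `z_k` of the run on the perturbed sample
(`integral_popRisk_sgdAverage_eq`). For a smooth nonnegative loss this is at most `1 + L / γ` times
the loss at `z_k` of the unperturbed run, plus `(L + γ) / 2` times the squared distance of the two
averages (`le_mul_add_sq_norm_sub`).

Stability: gradient steps on a common loss and projections are nonexpansive, so the two runs
separate only when the index `k` is drawn, which has probability `1 / n`. The squared gradients that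
then enter are bounded by the losses themselves, and a Grönwall argument over `T` steps costs only a
factor `3` (`integral_sq_norm_sgd_sub_update_le`).

Optimization: the descent inequality for the distance to a point `u` of the domain bounds the summed
expected training losses by a multiple of `‖u‖ ^ 2 / (2 * η) + T * F(u)`
(`sum_integral_expSampleLoss_le`). Averaging over `k` and inserting this gives
`integral_popRisk_sgdAverage_le`. With `γ = √n` and `η = c / √T` all errors are of order `1 / √n`;
if `F(w*) = 0`, then `γ = 1` and a constant step give `1 / n`.

The absolute value also demands a lower bound: the starting point `0` may lie outside `Ω`, so the
average may have a risk below `F(w*)`, but only by `O(1 / T)` (`popRisk_sub_le_popRisk_sgdAverage`).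
-/

/-! ### Smooth convex functions: self-bounding gradients, co-coercivity, nonexpansive gradient
steps. -/

section Smooth

variable {E : Type*} [NormedAddCommGroup E] [InnerProductSpace ℝ E] [CompleteSpace E]

theorem hasDerivAt_comp_line {g : E → ℝ} (hg : Differentiable ℝ g) (x v : E) (s : ℝ) :
    HasDerivAt (fun s : ℝ => g (x + s • v)) (inner ℝ (gradient g (x + s • v)) v) s := by
  have h1 : HasFDerivAt g (fderiv ℝ g (x + s • v)) (x + s • v) := (hg _).hasFDerivAt
  have h2 : HasDerivAt (fun s : ℝ => x + s • v) v s := by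
    simpa using ((hasDerivAt_id s).smul_const v).const_add x
  have h3 := h1.comp_hasDerivAt s h2
  have h4 : inner ℝ (gradient g (x + s • v)) v = fderiv ℝ g (x + s • v) v := by
    simp [gradient]
  rw [h4]
  exact h3

theorem ConvexOn.add_inner_gradient_le {g : E → ℝ} (hc : ConvexOn ℝ Set.univ g)
    (hg : Differentiable ℝ g) (x y : E) : g x + inner ℝ (gradient g x) (y - x) ≤ g y := by
  have hφ : ConvexOn ℝ Set.univ (fun s : ℝ => g (x + s • (y - x))) := by
    have := hc.comp_affineMap (AffineMap.lineMap (k := ℝ) x y)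
    simp only [Set.preimage_univ] at this
    refine this.congr fun s _ => ?_
    simp [AffineMap.lineMap_apply, add_comm]
  have h := hφ.le_slope_of_hasDerivAt (Set.mem_univ 0) (Set.mem_univ 1) one_pos
    (hasDerivAt_comp_line hg x (y - x) 0)
  simp only [slope_def_field, zero_smul, add_zero, one_smul, add_sub_cancel, sub_zero, div_one] at h
  linarith

theorem le_add_inner_gradient_add_sq {g : E → ℝ} {L : ℝ} (hg : Differentiable ℝ g)
    (hL : ∀ x y, ‖gradient g x - gradient g y‖ ≤ L * ‖x - y‖) (x y : E) :
    g y ≤ g x + inner ℝ (gradient g x) (y - x) + L / 2 * ‖y - x‖ ^ 2 := by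
  set v := y - x with hv
  -- The gap to the quadratic upper model along the segment: its derivative is nonpositive by the
  -- Lipschitz bound, and its values at `0` and `1` give the claim.
  let h : ℝ → ℝ := fun s => g (x + s • v) - s * inner ℝ (gradient g x) v - L / 2 * s ^ 2 * ‖v‖ ^ 2
  have hd : ∀ s, HasDerivAt h
      (inner ℝ (gradient g (x + s • v)) v - inner ℝ (gradient g x) v - L * s * ‖v‖ ^ 2) s := by
    intro s
    have h1 := hasDerivAt_comp_line hg x v s
    have h2 := (hasDerivAt_id s).mul_const (inner ℝ (gradient g x) v)
    have h3 := (((hasDerivAt_id s).pow 2).const_mul (L / 2)).mul_const (‖v‖ ^ 2)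
    refine ((h1.sub h2).sub h3).congr_deriv ?_
    simp only [Nat.cast_ofNat, id_eq]
    ring
  have ha : AntitoneOn h (Set.Icc 0 1) := by
    refine antitoneOn_of_deriv_nonpos (convex_Icc 0 1)
      (fun s _ => (hd s).continuousAt.continuousWithinAt)
      (fun s _ => (hd s).differentiableAt.differentiableWithinAt) fun s hs => ?_
    rw [interior_Icc] at hs
    rw [(hd s).deriv, ← inner_sub_left]
    have h1 := real_inner_le_norm (gradient g (x + s • v) - gradient g x) v
    have h2 := hL (x + s • v) x
    rw [add_sub_cancel_left, norm_smul, Real.norm_of_nonneg hs.1.le] at h2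
    nlinarith [mul_le_mul_of_nonneg_right h2 (norm_nonneg v)]
  have := ha (by simp) (by simp) zero_le_one
  simp only [h, zero_smul, add_zero, one_smul, hv, add_sub_cancel] at this
  linarith

/-- A gradient step of length `1 / L` lowers `g` by at least `‖∇g‖ ^ 2 / (2 * L)`, and it cannot go
below zero. -/
theorem sq_norm_gradient_le {g : E → ℝ} {L : ℝ} (hLpos : 0 < L) (hg : Differentiable ℝ g)
    (hL : ∀ x y, ‖gradient g x - gradient g y‖ ≤ L * ‖x - y‖) (h0 : ∀ x, 0 ≤ g x) (x : E) :
    ‖gradient g x‖ ^ 2 ≤ 2 * L * g x := by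
  have h := le_add_inner_gradient_add_sq hg hL x (x - L⁻¹ • gradient g x)
  have h1 := h0 (x - L⁻¹ • gradient g x)
  rw [sub_sub_cancel_left, inner_neg_right, inner_smul_right, real_inner_self_eq_norm_sq, norm_neg,
    norm_smul, Real.norm_of_nonneg (inv_nonneg.2 hLpos.le)] at h
  have h2 : L / 2 * (L⁻¹ * ‖gradient g x‖) ^ 2 = L⁻¹ * ‖gradient g x‖ ^ 2 / 2 := by
    field_simp
  rw [h2] at h
  have h3 : L⁻¹ * ‖gradient g x‖ ^ 2 ≤ 2 * g x := by linarith
  rw [inv_mul_le_iff₀ hLpos] at h3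
  linarith

/-- The linear term of the quadratic upper model is split by Young's inequality with weight `γ`, and
the squared gradient is absorbed into `g v` by self-bounding. The choice of `γ` trades the
multiplicative loss against the weight of the distance. -/
theorem le_mul_add_sq_norm_sub {g : E → ℝ} {L γ : ℝ} (hLpos : 0 < L) (hγ : 0 < γ)
    (hg : Differentiable ℝ g)
    (hL : ∀ x y, ‖gradient g x - gradient g y‖ ≤ L * ‖x - y‖) (h0 : ∀ x, 0 ≤ g x) (u v : E) :
    g u ≤ (1 + L / γ) * g v + (L + γ) / 2 * ‖u - v‖ ^ 2 := by
  have h := le_add_inner_gradient_add_sq hg hL v u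
  have h1 := real_inner_le_norm (gradient g v) (u - v)
  have h2 := sq_norm_gradient_le hLpos hg hL h0 v
  have h3 : ‖gradient g v‖ * ‖u - v‖ ≤ ‖gradient g v‖ ^ 2 / (2 * γ) + γ / 2 * ‖u - v‖ ^ 2 := by
    rw [← sub_nonneg]
    have : ‖gradient g v‖ ^ 2 / (2 * γ) + γ / 2 * ‖u - v‖ ^ 2 - ‖gradient g v‖ * ‖u - v‖
        = (‖gradient g v‖ - γ * ‖u - v‖) ^ 2 / (2 * γ) := by
      field_simp
      ring
    rw [this]
    positivity
  have h4 : ‖gradient g v‖ ^ 2 / (2 * γ) ≤ L / γ * g v := by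
    rw [div_le_iff₀ (by positivity)]
    refine h2.trans (le_of_eq ?_)
    field_simp
  linarith

/-- Co-coercivity: at the point `y - L⁻¹ • D` the convexity bound from `x` meets the smoothness
bound from `y`; the resulting inequality is added to its mirror image. -/
theorem sq_norm_gradient_sub_le {g : E → ℝ} {L : ℝ} (hLpos : 0 < L) (hg : Differentiable ℝ g)
    (hc : ConvexOn ℝ Set.univ g)
    (hL : ∀ x y, ‖gradient g x - gradient g y‖ ≤ L * ‖x - y‖) (x y : E) :
    ‖gradient g x - gradient g y‖ ^ 2 ≤ L * inner ℝ (gradient g x - gradient g y) (x - y) := by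
  have key : ∀ x y, g x + inner ℝ (gradient g x) (y - x)
      + L⁻¹ * ‖gradient g y - gradient g x‖ ^ 2 / 2 ≤ g y := by
    intro x y
    set D := gradient g y - gradient g x with hD
    have h1 := hc.add_inner_gradient_le hg x (y - L⁻¹ • D)
    have h2 := le_add_inner_gradient_add_sq hg hL y (y - L⁻¹ • D)
    rw [sub_sub_cancel_left, inner_neg_right, inner_smul_right, norm_neg,
      norm_smul, Real.norm_of_nonneg (inv_nonneg.2 hLpos.le)] at h2
    rw [sub_right_comm, inner_sub_right, inner_smul_right] at h1
    have h3 : L / 2 * (L⁻¹ * ‖D‖) ^ 2 = L⁻¹ * ‖D‖ ^ 2 / 2 := by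
      field_simp
    have h4 : inner ℝ (gradient g y) D - inner ℝ (gradient g x) D = ‖D‖ ^ 2 := by
      rw [← inner_sub_left, ← hD, real_inner_self_eq_norm_sq]
    rw [← h4, mul_sub] at h3 ⊢
    linarith
  have h1 := key x y
  have h2 := key y x
  rw [norm_sub_rev (gradient g y)] at h1
  have h3 : inner ℝ (gradient g x - gradient g y) (x - y)
      = -(inner ℝ (gradient g x) (y - x)) - inner ℝ (gradient g y) (x - y) := by
    rw [inner_sub_left, ← inner_neg_right, neg_sub]
  have h4 : L⁻¹ * ‖gradient g x - gradient g y‖ ^ 2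
      ≤ inner ℝ (gradient g x - gradient g y) (x - y) := by
    linarith
  rwa [inv_mul_le_iff₀ hLpos] at h4

theorem norm_gradient_step_sub_le {g : E → ℝ} {L η : ℝ} (hLpos : 0 < L) (hη : 0 ≤ η)
    (hηL : η * L ≤ 2) (hg : Differentiable ℝ g) (hc : ConvexOn ℝ Set.univ g)
    (hL : ∀ x y, ‖gradient g x - gradient g y‖ ≤ L * ‖x - y‖) (x y : E) :
    ‖(x - η • gradient g x) - (y - η • gradient g y)‖ ≤ ‖x - y‖ := by
  have h := sq_norm_gradient_sub_le hLpos hg hc hL x y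
  set D := gradient g x - gradient g y with hD
  have e : (x - η • gradient g x) - (y - η • gradient g y) = (x - y) - η • D := by
    rw [hD, smul_sub]
    abel
  rw [e]
  refine le_of_sq_le_sq ?_ (norm_nonneg _)
  rw [norm_sub_sq_real, inner_smul_right, norm_smul, Real.norm_of_nonneg hη, real_inner_comm]
  have hi : 0 ≤ inner ℝ D (x - y) := by
    by_contra hneg
    push Not at hneg
    nlinarith [sq_nonneg ‖D‖]
  have : η * (η * ‖D‖ ^ 2) ≤ η * (2 * inner ℝ D (x - y)) := by
    refine mul_le_mul_of_nonneg_left ?_ hη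
    calc η * ‖D‖ ^ 2 ≤ η * (L * inner ℝ D (x - y)) := mul_le_mul_of_nonneg_left h hη
      _ = (η * L) * inner ℝ D (x - y) := by ring
      _ ≤ _ := mul_le_mul_of_nonneg_right hηL hi
  nlinarith

end Smooth

/-! ### Euclidean projection: variational inequality and nonexpansiveness. -/

section Projection

variable {d : ℕ} {Ω : Set (Param d)}

theorem inner_sub_projOn_nonpos (hne : Ω.Nonempty) (hcl : IsClosed Ω) (hcv : Convex ℝ Ω)
    (x : Param d) {u : Param d} (hu : u ∈ Ω) :
    inner ℝ (x - projOn Ω x) (u - projOn Ω x) ≤ 0 := by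
  obtain ⟨h1, h2⟩ := (projOn_spec hne hcl hcv x).1
  refine (norm_eq_iInf_iff_real_inner_le_zero hcv h1).1 ?_ u hu
  rw [← dist_eq_norm, h2, Metric.infDist_eq_iInf]
  simp only [dist_eq_norm]

theorem norm_projOn_sub_projOn_le (hne : Ω.Nonempty) (hcl : IsClosed Ω) (hcv : Convex ℝ Ω)
    (x y : Param d) : ‖projOn Ω x - projOn Ω y‖ ≤ ‖x - y‖ := by
  have h1 := inner_sub_projOn_nonpos hne hcl hcv x (projOn_spec hne hcl hcv y).1.1
  have h2 := inner_sub_projOn_nonpos hne hcl hcv y (projOn_spec hne hcl hcv x).1.1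
  set p := projOn Ω x
  set q := projOn Ω y
  have e : inner ℝ (x - y) (p - q) = ‖p - q‖ ^ 2 - inner ℝ (x - p) (q - p)
      - inner ℝ (y - q) (p - q) := by
    rw [← real_inner_self_eq_norm_sq, ← neg_sub p q, inner_neg_right, sub_neg_eq_add,
      ← inner_add_left, ← inner_sub_left]
    congr 1
    abel
  have h3 := real_inner_le_norm (x - y) (p - q)
  by_contra! hlt
  have h4 : 0 ≤ ‖x - y‖ := norm_nonneg _
  nlinarith

theorem continuous_projOn (hne : Ω.Nonempty) (hcl : IsClosed Ω) (hcv : Convex ℝ Ω) :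
    Continuous (projOn Ω) := by
  refine (LipschitzWith.of_dist_le_mul (K := 1) fun x y => ?_).continuous
  simpa [dist_eq_norm] using norm_projOn_sub_projOn_le hne hcl hcv x y

theorem projOn_eq_self (hne : Ω.Nonempty) (hcl : IsClosed Ω) (hcv : Convex ℝ Ω) {y : Param d}
    (hy : y ∈ Ω) : projOn Ω y = y :=
  ((projOn_spec hne hcl hcv y).2 y hy (by rw [dist_self, Metric.infDist_zero_of_mem hy])).symm

theorem norm_projOn_sub_le (hne : Ω.Nonempty) (hcl : IsClosed Ω) (hcv : Convex ℝ Ω)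
    (x : Param d) {y : Param d} (hy : y ∈ Ω) : ‖projOn Ω x - y‖ ≤ ‖x - y‖ := by
  simpa [projOn_eq_self hne hcl hcv hy] using norm_projOn_sub_projOn_le hne hcl hcv x y

end Projection

/-! ### Uniform averages and Jensen's inequality. -/

section Average

theorem ConvexOn.map_inv_smul_sum_range_le {E : Type*} [AddCommGroup E] [Module ℝ E] {g : E → ℝ}
    (hg : ConvexOn ℝ Set.univ g) {T : ℕ} (hT : 0 < T) (x : ℕ → E) :
    g ((T : ℝ)⁻¹ • ∑ t ∈ Finset.range T, x t) ≤ (T : ℝ)⁻¹ * ∑ t ∈ Finset.range T, g (x t) := by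
  have hT' : (T : ℝ) ≠ 0 := by positivity
  have h := hg.map_sum_le (t := Finset.range T) (w := fun _ => (T : ℝ)⁻¹) (p := x)
    (fun _ _ => by positivity) (by simp [hT']) (fun _ _ => Set.mem_univ _)
  rw [Finset.smul_sum, Finset.mul_sum]
  simpa using h

theorem sq_norm_average_le {E : Type*} [SeminormedAddCommGroup E] [NormedSpace ℝ E]
    {T : ℕ} (hT : 0 < T) (x : ℕ → E) :
    ‖(T : ℝ)⁻¹ • ∑ t ∈ Finset.range T, x t‖ ^ 2
      ≤ (T : ℝ)⁻¹ * ∑ t ∈ Finset.range T, ‖x t‖ ^ 2 := by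
  have h : ConvexOn ℝ Set.univ (fun x : E => ‖x‖ ^ 2) :=
    (convexOn_univ_norm (E := E)).pow (fun x _ => norm_nonneg x) 2
  exact h.map_inv_smul_sum_range_le hT x

theorem average_sub_average {E : Type*} [AddCommGroup E] [Module ℝ E] (T : ℕ) (x y : ℕ → E) :
    (T : ℝ)⁻¹ • ∑ t ∈ Finset.range T, x t - (T : ℝ)⁻¹ • ∑ t ∈ Finset.range T, y t
      = (T : ℝ)⁻¹ • ∑ t ∈ Finset.range T, (x t - y t) := by
  rw [← smul_sub, Finset.sum_sub_distrib]

theorem average_sub_const {E : Type*} [AddCommGroup E] [Module ℝ E] {T : ℕ} (hT : 0 < T)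
    (x : ℕ → E) (c : E) :
    (T : ℝ)⁻¹ • ∑ t ∈ Finset.range T, x t - c
      = (T : ℝ)⁻¹ • ∑ t ∈ Finset.range T, (x t - c) := by
  have hT' : (T : ℝ) ≠ 0 := by positivity
  rw [← average_sub_average, Finset.sum_const, Finset.card_range, ← Nat.cast_smul_eq_nsmul ℝ,
    inv_smul_smul₀ hT']

end Average

/-! ### Estimates along a fixed sample and a fixed index sequence. -/

section Path

variable {d n : ℕ} {Z : Type*} {L η : ℝ} {Ω : Set (Param d)} {f : Param d → Z → ℝ}

theorem sgdAverage_const (hη : 0 < η) (S : Fin n → Z) (i : ℕ → Fin n) (T : ℕ) :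
    sgdAverage Ω f (fun _ => η) S i T
      = (T : ℝ)⁻¹ • ∑ t ∈ Finset.range T, sgd Ω f (fun _ => η) S i t := by
  rw [sgdAverage, ← Finset.smul_sum, smul_smul, Finset.sum_const, Finset.card_range,
    nsmul_eq_mul, mul_inv, mul_assoc, inv_mul_cancel₀ hη.ne', mul_one]

/-- The iterate sees only the indices drawn before it. This yields both integrability, since only
finitely many values occur, and independence from the current index. -/
theorem dependsOn_sgd (η : ℕ → ℝ) (S : Fin n → Z) (t : ℕ) :
    DependsOn (fun i : ℕ → Fin n => sgd Ω f η S i t) (Set.Iio t) := by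
  induction t with
  | zero => exact fun _ _ _ => rfl
  | succ t ih =>
    intro i j hij
    have h1 := ih fun s hs => hij s (Set.mem_Iio.2 ((Set.mem_Iio.1 hs).trans t.lt_succ_self))
    have h2 := hij t (Set.mem_Iio.2 t.lt_succ_self)
    simp only [sgd] at h1 ⊢
    rw [h1, h2]

theorem dependsOn_sgdAverage (η : ℕ → ℝ) (S : Fin n → Z) (T : ℕ) :
    DependsOn (fun i : ℕ → Fin n => sgdAverage Ω f η S i T) (Set.Iio T) := by
  intro i j hij
  simp only [sgdAverage]
  congr 1
  refine Finset.sum_congr rfl fun t ht => ?_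
  exact congrArg (η t • ·) (dependsOn_sgd η S t fun s hs => hij s
    (Set.mem_Iio.2 ((Set.mem_Iio.1 hs).trans (Finset.mem_range.1 ht))))

/-- Expand the square after the projection: convexity handles the cross term, and self-bounding
turns `η ^ 2 * ‖G‖ ^ 2` into `2 * L * η ^ 2` times the loss, whence the factor `1 - L * η`. Only `u`
has to lie in `Ω`, not the current iterate. -/
theorem sq_norm_sgd_succ_sub_le (hf : IsSmoothConvexLoss L f) (hL : 0 < L) (hη : 0 < η)
    (hne : Ω.Nonempty) (hcl : IsClosed Ω) (hcv : Convex ℝ Ω) {u : Param d} (hu : u ∈ Ω)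
    (S : Fin n → Z) (i : ℕ → Fin n) (t : ℕ) :
    ‖sgd Ω f (fun _ => η) S i (t + 1) - u‖ ^ 2
        + 2 * η * (1 - L * η) * f (sgd Ω f (fun _ => η) S i t) (S (i t))
      ≤ ‖sgd Ω f (fun _ => η) S i t - u‖ ^ 2 + 2 * η * f u (S (i t)) := by
  rw [sgd]
  set w := sgd Ω f (fun _ => η) S i t
  set z := S (i t)
  set G := gradient (fun u => f u z) w with hG
  have h1 := norm_projOn_sub_le hne hcl hcv (w - η • G) hu
  have h2 := pow_le_pow_left₀ (norm_nonneg _) h1 2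
  have h3 := (hf.convex z).add_inner_gradient_le (hf.differentiable z) w u
  have h4 := sq_norm_gradient_le hL (hf.differentiable z) (hf.smooth z)
    (fun w => hf.nonneg w z) w
  rw [← hG] at h3 h4
  rw [sub_right_comm, norm_sub_sq_real (w - u), inner_smul_right, norm_smul, Real.norm_of_nonneg hη.le,
    real_inner_comm, ← neg_sub u w, inner_neg_right, norm_neg] at h2
  rw [norm_sub_rev w u]
  have h5 := mul_le_mul_of_nonneg_left h4 (sq_nonneg η)
  have h6 := mul_le_mul_of_nonneg_left h3 hη.le
  nlinarith

theorem sq_norm_sgd_sub_add_sum_le (hf : IsSmoothConvexLoss L f) (hL : 0 < L) (hη : 0 < η)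
    (hne : Ω.Nonempty) (hcl : IsClosed Ω) (hcv : Convex ℝ Ω) {u : Param d} (hu : u ∈ Ω)
    (S : Fin n → Z) (i : ℕ → Fin n) (T : ℕ) :
    ‖sgd Ω f (fun _ => η) S i T - u‖ ^ 2
        + 2 * η * (1 - L * η)
          * ∑ t ∈ Finset.range T, f (sgd Ω f (fun _ => η) S i t) (S (i t))
      ≤ ‖u‖ ^ 2 + 2 * η * ∑ t ∈ Finset.range T, f u (S (i t)) := by
  induction T with
  | zero => simp [sgd]
  | succ T ih =>
    have h := sq_norm_sgd_succ_sub_le hf hL hη hne hcl hcv hu S i T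
    rw [Finset.sum_range_succ, Finset.sum_range_succ, mul_add, mul_add]
    linarith

/-- A crude bound, uniform in the indices; it serves only to dominate integrands, not to obtain
rates. -/
theorem sum_comp_index_le (hf : IsSmoothConvexLoss L f) (u : Param d) (S : Fin n → Z)
    (i : ℕ → Fin n) (T : ℕ) :
    ∑ t ∈ Finset.range T, f u (S (i t)) ≤ T * ∑ k, f u (S k) := by
  refine (Finset.sum_le_card_nsmul _ _ (∑ k, f u (S k)) fun t _ => ?_).trans (by simp)
  exact Finset.single_le_sum (f := fun k => f u (S k)) (fun k _ => hf.nonneg u (S k))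
    (Finset.mem_univ (i t))

theorem sq_norm_sgd_sub_le (hf : IsSmoothConvexLoss L f) (hL : 0 < L) (hη : 0 < η)
    (hηL : η * L ≤ 1) (hne : Ω.Nonempty) (hcl : IsClosed Ω) (hcv : Convex ℝ Ω)
    {u : Param d} (hu : u ∈ Ω) (S : Fin n → Z) (i : ℕ → Fin n) (T : ℕ) :
    ‖sgd Ω f (fun _ => η) S i T - u‖ ^ 2 ≤ ‖u‖ ^ 2 + 2 * η * (T * ∑ k, f u (S k)) := by
  have h1 := sq_norm_sgd_sub_add_sum_le hf hL hη hne hcl hcv hu S i T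
  have h2 := mul_le_mul_of_nonneg_left (sum_comp_index_le hf u S i T)
    (by positivity : 0 ≤ 2 * η)
  have h3 : 0 ≤ 2 * η * (1 - L * η)
      * ∑ t ∈ Finset.range T, f (sgd Ω f (fun _ => η) S i t) (S (i t)) :=
    mul_nonneg (mul_nonneg (by positivity) (by linarith))
      (Finset.sum_nonneg fun t _ => hf.nonneg _ _)
  linarith

theorem sq_norm_sgdAverage_sub_le (hf : IsSmoothConvexLoss L f) (hL : 0 < L) (hη : 0 < η)
    (hηL : η * L ≤ 1) (hne : Ω.Nonempty) (hcl : IsClosed Ω) (hcv : Convex ℝ Ω)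
    {u : Param d} (hu : u ∈ Ω) (S : Fin n → Z) (i : ℕ → Fin n) {T : ℕ} (hT : 0 < T) :
    ‖sgdAverage Ω f (fun _ => η) S i T - u‖ ^ 2
      ≤ ‖u‖ ^ 2 + 2 * η * (T * ∑ k, f u (S k)) := by
  rw [sgdAverage_const hη, average_sub_const hT]
  refine (sq_norm_average_le hT _).trans ?_
  rw [inv_mul_le_iff₀ (by positivity)]
  refine (Finset.sum_le_card_nsmul _ _ (‖u‖ ^ 2 + 2 * η * (T * ∑ k, f u (S k)))
    fun t ht => ?_).trans (by rw [Finset.card_range, nsmul_eq_mul])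
  refine (sq_norm_sgd_sub_le hf hL hη hηL hne hcl hcv hu S i t).trans ?_
  have h0 : 0 ≤ ∑ k, f u (S k) := Finset.sum_nonneg fun k _ => hf.nonneg _ _
  have ht' : (t : ℝ) ≤ T := by exact_mod_cast (Finset.mem_range.1 ht).le
  gcongr

/-- One step of two runs of SGD whose samples differ only in position `k`. -/
theorem sq_norm_sgd_succ_sub_sgd_update_succ_le (hf : IsSmoothConvexLoss L f) (hL : 0 < L)
    (hη : 0 < η) (hηL : η * L ≤ 2) (hne : Ω.Nonempty) (hcl : IsClosed Ω) (hcv : Convex ℝ Ω)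
    {p : ℝ} (hp : 0 < p) (S : Fin n → Z) (k : Fin n) (z' : Z) (i : ℕ → Fin n) (t : ℕ) :
    ‖sgd Ω f (fun _ => η) S i (t + 1)
        - sgd Ω f (fun _ => η) (Function.update S k z') i (t + 1)‖ ^ 2
      ≤ ‖sgd Ω f (fun _ => η) S i t
          - sgd Ω f (fun _ => η) (Function.update S k z') i t‖ ^ 2
        + if i t = k then
            p * ‖sgd Ω f (fun _ => η) S i t
              - sgd Ω f (fun _ => η) (Function.update S k z') i t‖ ^ 2
            + (1 + p⁻¹) * (4 * L * η ^ 2) * (f (sgd Ω f (fun _ => η) S i t) (S k)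
              + f (sgd Ω f (fun _ => η) (Function.update S k z') i t) z')
          else 0 := by
  rw [sgd, sgd]
  set w := sgd Ω f (fun _ => η) S i t
  set v := sgd Ω f (fun _ => η) (Function.update S k z') i t
  have h1 := pow_le_pow_left₀ (norm_nonneg _) (norm_projOn_sub_projOn_le hne hcl hcv
    (w - η • gradient (fun u => f u (S (i t))) w)
    (v - η • gradient (fun u => f u (Function.update S k z' (i t))) v)) 2
  refine h1.trans ?_
  split_ifs with hk
  · rw [hk, Function.update_self]
    set G := gradient (fun u => f u (S k)) w with hG
    set H := gradient (fun u => f u z') v with hH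
    have hG' := sq_norm_gradient_le hL (hf.differentiable (S k)) (hf.smooth (S k))
      (fun w => hf.nonneg w (S k)) w
    have hH' := sq_norm_gradient_le hL (hf.differentiable z') (hf.smooth z')
      (fun w => hf.nonneg w z') v
    rw [← hG] at hG'
    rw [← hH] at hH'
    have e : (w - η • G) - (v - η • H) = (w - v) - η • (G - H) := by
      rw [smul_sub]
      abel
    have h2 : ‖(w - v) - η • (G - H)‖ ≤ ‖w - v‖ + η * (‖G‖ + ‖H‖) := by
      refine (norm_sub_le _ _).trans ?_
      rw [norm_smul, Real.norm_of_nonneg hη.le]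
      gcongr
      exact norm_sub_le _ _
    have h3 := pow_le_pow_left₀ (norm_nonneg _) h2 2
    rw [e]
    refine h3.trans ?_
    set A := ‖w - v‖
    set B := η * (‖G‖ + ‖H‖) with hB
    -- Young's inequality with weight `p`, which is later matched to the horizon.
    have h4 : (A + B) ^ 2 ≤ (1 + p) * A ^ 2 + (1 + p⁻¹) * B ^ 2 := by
      have : (1 + p) * A ^ 2 + (1 + p⁻¹) * B ^ 2 - (A + B) ^ 2 = (p * A - B) ^ 2 / p := by
        field_simp
        ring
      have h5 : 0 ≤ (p * A - B) ^ 2 / p := by positivity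
      linarith
    have h5 : B ^ 2 ≤ 4 * L * η ^ 2 * (f w (S k) + f v z') := by
      have h6 : (‖G‖ + ‖H‖) ^ 2 ≤ 2 * (‖G‖ ^ 2 + ‖H‖ ^ 2) := add_sq_le
      calc B ^ 2 = η ^ 2 * (‖G‖ + ‖H‖) ^ 2 := by rw [hB]; ring
        _ ≤ η ^ 2 * (4 * L * (f w (S k) + f v z')) := by
          refine mul_le_mul_of_nonneg_left ?_ (sq_nonneg η)
          linarith
        _ = _ := by ring
    have h6 := mul_le_mul_of_nonneg_left h5 (by positivity : 0 ≤ 1 + p⁻¹)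
    linarith
  -- Both runs use the same sample point here, so the gradient step is nonexpansive.
  · rw [Function.update_of_ne hk, add_zero]
    exact pow_le_pow_left₀ (norm_nonneg _) (norm_gradient_step_sub_le hL hη.le hηL
      (hf.differentiable _) (hf.convex _) (hf.smooth _) w v) 2

end Path

/-! ### Joint measurability of the loss, its gradient and the iterates. -/

section Measurability

variable {d n : ℕ} {Z : Type*} [MeasurableSpace Z] {L : ℝ} {Ω : Set (Param d)}
  {f : Param d → Z → ℝ}

/-- Directional derivatives are pointwise limits of difference quotients with increments `1 / (m +
1)`; the gradient is recovered from its coordinates. -/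
theorem measurable_gradient_of_measurable (hm : ∀ w, Measurable (f w))
    (hd : ∀ z, Differentiable ℝ (fun w => f w z)) (w : Param d) :
    Measurable fun z => gradient (fun u => f u z) w := by
  have key : ∀ v : Param d, Measurable fun z => inner ℝ (gradient (fun u => f u z) w) v := by
    intro v
    refine measurable_of_tendsto_metrizable (f := fun (m : ℕ) z =>
      (1 / ((m : ℝ) + 1))⁻¹ * (f (w + (1 / ((m : ℝ) + 1)) • v) z - f w z))
      (fun m => (((hm _).sub (hm _)).const_mul _)) ?_
    rw [tendsto_pi_nhds]
    intro z
    have h := (hasDerivAt_comp_line (hd z) w v 0).tendsto_slope_zero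
    have h2 : Filter.Tendsto (fun m : ℕ => 1 / ((m : ℝ) + 1)) Filter.atTop
        (nhdsWithin 0 {0}ᶜ) :=
      tendsto_nhdsWithin_iff.2 ⟨tendsto_one_div_add_atTop_nhds_zero_nat,
        Filter.Eventually.of_forall fun m => by
          have : (0 : ℝ) < 1 / ((m : ℝ) + 1) := by positivity
          exact this.ne'⟩
    simpa [Function.comp_def] using h.comp h2
  have e : (fun z => gradient (fun u => f u z) w) = fun z =>
      ∑ j, inner ℝ (gradient (fun u => f u z) w) (EuclideanSpace.basisFun (Fin d) ℝ j)
        • EuclideanSpace.basisFun (Fin d) ℝ j := by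
    funext z
    conv_lhs => rw [← (EuclideanSpace.basisFun (Fin d) ℝ).sum_repr' (gradient (fun u => f u z) w)]
    simp only [real_inner_comm]
  rw [e]
  exact Finset.measurable_sum _ fun j _ => (key _).smul_const _

theorem measurable_uncurry_loss (hm : ∀ w, Measurable (f w)) (hf : IsSmoothConvexLoss L f) :
    Measurable (Function.uncurry f) :=
  measurable_uncurry_of_continuous_of_measurable (u := f)
    (fun z => (hf.differentiable z).continuous) hm

theorem measurable_uncurry_gradient (hm : ∀ w, Measurable (f w))
    (hf : IsSmoothConvexLoss L f) :
    Measurable (Function.uncurry fun (w : Param d) z => gradient (fun u => f u z) w) := by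
  refine measurable_uncurry_of_continuous_of_measurable
    (u := fun (w : Param d) z => gradient (fun u => f u z) w) (fun z => ?_)
    (measurable_gradient_of_measurable hm hf.differentiable)
  refine (LipschitzWith.of_dist_le_mul (K := L.toNNReal) fun x y => ?_).continuous
  rw [dist_eq_norm, dist_eq_norm]
  exact (hf.smooth z x y).trans
    (mul_le_mul_of_nonneg_right (Real.le_coe_toNNReal L) (norm_nonneg _))

theorem measurable_sample_index (t : ℕ) :
    Measurable fun p : (Fin n → Z) × (ℕ → Fin n) => p.1 (p.2 t) := by
  have h : Measurable fun q : (Fin n → Z) × Fin n => q.1 q.2 :=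
    measurable_from_prod_countable_left fun k => measurable_pi_apply k
  exact h.comp (measurable_fst.prodMk ((measurable_pi_apply t).comp measurable_snd))

theorem measurable_sgd (hm : ∀ w, Measurable (f w)) (hf : IsSmoothConvexLoss L f)
    (hne : Ω.Nonempty) (hcl : IsClosed Ω) (hcv : Convex ℝ Ω) (η : ℕ → ℝ) (t : ℕ) :
    Measurable fun p : (Fin n → Z) × (ℕ → Fin n) => sgd Ω f η p.1 p.2 t := by
  induction t with
  | zero => exact measurable_const
  | succ t ih =>
    simp only [sgd]
    refine (continuous_projOn hne hcl hcv).measurable.comp (ih.sub ?_)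
    exact ((measurable_uncurry_gradient hm hf).comp
      (ih.prodMk (measurable_sample_index t))).const_smul (η t)

theorem measurable_sgdAverage (hm : ∀ w, Measurable (f w)) (hf : IsSmoothConvexLoss L f)
    (hne : Ω.Nonempty) (hcl : IsClosed Ω) (hcv : Convex ℝ Ω) (η : ℕ → ℝ) (T : ℕ) :
    Measurable fun p : (Fin n → Z) × (ℕ → Fin n) => sgdAverage Ω f η p.1 p.2 T := by
  unfold sgdAverage
  refine Measurable.const_smul (g := fun p : (Fin n → Z) × (ℕ → Fin n) =>
    ∑ t ∈ Finset.range T, η t • sgd Ω f η p.1 p.2 t) ?_ (∑ t ∈ Finset.range T, η t)⁻¹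
  exact Finset.measurable_sum _ fun t _ =>
    (measurable_sgd hm hf hne hcl hcv η t).const_smul (η t)

end Measurability

/-! ### Expectations over the drawn indices. -/

section Index

/-- The law of the drawn indices: i.i.d. and uniform on the `n` sample positions. -/
noncomputable abbrev indexLaw (n : ℕ) [NeZero n] : Measure (ℕ → Fin n) :=
  Measure.infinitePi fun _ : ℕ => (PMF.uniformOfFintype (Fin n)).toMeasure

variable {n : ℕ} [NeZero n]

theorem exists_eq_comp_restrict_of_dependsOn {G : (ℕ → Fin n) → ℝ} {t : ℕ}
    (hG : DependsOn G (Set.Iio t)) :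
    ∃ g : (↥(Finset.range t) → Fin n) → ℝ, G = fun i => g fun s => i s := by
  -- The filler index `0` beyond the first `t` positions is invisible to `G`.
  refine ⟨fun x => G fun s => if h : s ∈ Finset.range t then x ⟨s, h⟩ else 0, ?_⟩
  funext i
  refine hG fun s hs => ?_
  rw [dif_pos (Finset.mem_range.2 hs)]

theorem integrable_indexLaw_of_dependsOn {G : (ℕ → Fin n) → ℝ} {t : ℕ}
    (hG : DependsOn G (Set.Iio t)) : Integrable G (indexLaw n) := by
  obtain ⟨g, rfl⟩ := exists_eq_comp_restrict_of_dependsOn hG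
  have hm : Measurable fun (i : ℕ → Fin n) (s : ↥(Finset.range t)) => i s := by
    fun_prop
  have : IsFiniteMeasure
      ((indexLaw n).map fun (i : ℕ → Fin n) (s : ↥(Finset.range t)) => i s) :=
    inferInstance
  exact (Integrable.of_finite (f := g)).comp_measurable hm

/-- The index `i t` is uniform and independent of the earlier ones, on which alone `H` depends;
splitting over the value of `i t` by indicators makes each term a product. -/
theorem integral_indexLaw_eval {H : (ℕ → Fin n) → Fin n → ℝ} {t : ℕ}
    (hH : ∀ k, DependsOn (fun i => H i k) (Set.Iio t)) :
    ∫ i, H i (i t) ∂(indexLaw n) = (n : ℝ)⁻¹ * ∑ k, ∫ i, H i k ∂(indexLaw n) := by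
  have hind : iIndepFun (fun (s : ℕ) (i : ℕ → Fin n) => i s) (indexLaw n) :=
    iIndepFun_infinitePi (X := fun _ x => x) (fun _ => measurable_id)
  have hdisj : Disjoint ({t} : Finset ℕ) (Finset.range t) := by simp
  have hI := hind.indepFun_finset {t} (Finset.range t) hdisj fun s => measurable_pi_apply s
  have h1 : ∀ k, ∫ i, (if i t = k then (1 : ℝ) else 0) * H i k ∂(indexLaw n)
      = (n : ℝ)⁻¹ * ∫ i, H i k ∂(indexLaw n) := by
    intro k
    obtain ⟨g, hg⟩ := exists_eq_comp_restrict_of_dependsOn (hH k)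
    have h2 := (hI.comp (φ := fun x => if x ⟨t, Finset.mem_singleton_self t⟩ = k then (1 : ℝ) else 0)
      (ψ := g) (measurable_of_finite _) (measurable_of_finite _))
    have h3 : ∀ i, H i k = g fun s => i s := fun i => congrFun hg i
    have h4 : ∫ i, (if i t = k then (1 : ℝ) else 0) ∂(indexLaw n) = (n : ℝ)⁻¹ := by
      have h6 : ∫ i, (if i t = k then (1 : ℝ) else 0) ∂(indexLaw n)
          = ∫ j, (if j = k then (1 : ℝ) else 0) ∂(PMF.uniformOfFintype (Fin n)).toMeasure := by
        rw [← Measure.infinitePi_map_eval (fun _ : ℕ => (PMF.uniformOfFintype (Fin n)).toMeasure) t,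
          integral_map (measurable_pi_apply t).aemeasurable
            (measurable_of_finite _).aestronglyMeasurable]
      rw [h6, PMF.integral_eq_sum]
      simp
    rw [← h4]
    simp only [h3]
    exact h2.integral_fun_mul_eq_mul_integral
      ((measurable_of_finite _).comp (by fun_prop)).aestronglyMeasurable
      ((measurable_of_finite _).comp (by fun_prop)).aestronglyMeasurable
  have h2 : ∀ i, H i (i t) = ∑ k, (if i t = k then (1 : ℝ) else 0) * H i k := by
    intro i
    simp
  simp only [h2]
  rw [integral_finsetSum, Finset.mul_sum]
  · exact Finset.sum_congr rfl fun k _ => h1 k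
  · intro k _
    refine integrable_indexLaw_of_dependsOn (t := t + 1) fun i j hij => ?_
    have e1 : H i k = H j k :=
      hH k fun s hs => hij s (Set.mem_Iio.2 ((Set.mem_Iio.1 hs).trans t.lt_succ_self))
    simp only [e1, hij t (Set.mem_Iio.2 t.lt_succ_self)]

end Index

/-! ### Symmetry between a sample point and its independent copy. -/

section Exchange

variable {Z : Type*} [MeasurableSpace Z]

/-- Exchanging the `k`-th sample point with an independent copy preserves the law. -/
theorem measurePreserving_update_prod {n : ℕ} (ρ : Measure Z) [IsProbabilityMeasure ρ]
    (k : Fin n) :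
    MeasurePreserving (fun p : (Fin n → Z) × Z => (Function.update p.1 k p.2, p.1 k))
      ((Measure.pi fun _ : Fin n => ρ).prod ρ) ((Measure.pi fun _ : Fin n => ρ).prod ρ) := by
  -- Sample and copy form one i.i.d. family over `Fin n ⊕ Unit`, where the exchange is the
  -- transposition `σ` of two coordinates.
  let A : (Fin n ⊕ Unit → Z) → (Fin n → Z) × Z := fun s => (fun i => s (Sum.inl i), s (Sum.inr ()))
  have hA : MeasurePreserving A (Measure.pi fun _ => ρ) ((Measure.pi fun _ : Fin n => ρ).prod ρ) := by
    have h1 := measurePreserving_sumPiEquivProdPi (X := fun _ : Fin n ⊕ Unit => Z) (fun _ => ρ)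
    have h2 := (MeasurePreserving.id (Measure.pi fun _ : Fin n => ρ)).prod
      (measurePreserving_funUnique ρ Unit)
    exact h2.comp h1
  let σ : (Fin n ⊕ Unit → Z) → (Fin n ⊕ Unit → Z) :=
    fun s j => s (Equiv.swap (Sum.inl k) (Sum.inr ()) j)
  have hσ : MeasurePreserving σ (Measure.pi fun _ => ρ) (Measure.pi fun _ => ρ) :=
    (measurePreserving_piCongrLeft (fun _ : Fin n ⊕ Unit => ρ)
      (Equiv.swap (Sum.inl k) (Sum.inr ()))).symm
  have hm : Measurable fun p : (Fin n → Z) × Z => (Function.update p.1 k p.2, p.1 k) := by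
    refine Measurable.prodMk (measurable_pi_lambda _ fun j => ?_) (by fun_prop)
    by_cases h : j = k
    · subst h
      simpa using measurable_snd
    · simp only [Function.update_of_ne h]
      fun_prop
  refine hA.of_semiconj hσ (fun s => ?_) hm
  refine Prod.ext (funext fun j => ?_) ?_
  · by_cases h : j = k
    · subst h
      simp [A, σ]
    · simp only [A, σ, Function.update_of_ne h]
      rw [Equiv.swap_apply_of_ne_of_ne (by simpa using h) (by simp)]
  · simp [A, σ]

end Exchange

/-- The assumptions under which projected SGD with the constant step size `η` is analysed. -/
structure SGDAssumptions {d : ℕ} {Z : Type*} [MeasurableSpace Z] (L η : ℝ) (Ω : Set (Param d))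
    (f : Param d → Z → ℝ) (ρ : Measure Z) : Prop where
  smooth_pos : 0 < L
  step_pos : 0 < η
  step_le : η * L ≤ 1 / 2
  nonempty : Ω.Nonempty
  isClosed : IsClosed Ω
  convex : Convex ℝ Ω
  measurable : ∀ w, Measurable (f w)
  integrable : ∀ w, Integrable (f w) ρ
  loss : IsSmoothConvexLoss L f

/-- A discrete Grönwall inequality. -/
theorem le_pow_mul_sum_of_succ_le {D b : ℕ → ℝ} {q : ℝ} (hq : 1 ≤ q) (hb : ∀ t, 0 ≤ b t)
    (h0 : D 0 = 0) (h : ∀ t, D (t + 1) ≤ q * D t + b t) (t : ℕ) :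
    D t ≤ q ^ t * ∑ s ∈ Finset.range t, b s := by
  induction t with
  | zero => simp [h0]
  | succ t ih =>
    have h1 : b t ≤ q ^ (t + 1) * b t := le_mul_of_one_le_left (hb t) (one_le_pow₀ hq)
    calc D (t + 1) ≤ q * D t + b t := h t
      _ ≤ q * (q ^ t * ∑ s ∈ Finset.range t, b s) + q ^ (t + 1) * b t := by gcongr
      _ = _ := by rw [Finset.sum_range_succ]; ring

/-! ### Optimization and stability in expectation over the indices, for a fixed sample. -/

section FixedSample

variable {d n : ℕ} [NeZero n] {Z : Type*} {L η : ℝ} {Ω : Set (Param d)}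
  {f : Param d → Z → ℝ}

/-- The expected loss, over the drawn indices, of an SGD iterate at the `k`-th sample point. -/
noncomputable def expSampleLoss (Ω : Set (Param d)) (f : Param d → Z → ℝ) (η : ℝ) (t : ℕ)
    (S : Fin n → Z) (k : Fin n) : ℝ :=
  ∫ i, f (sgd Ω f (fun _ => η) S i t) (S k) ∂(indexLaw n)

theorem expSampleLoss_nonneg (hf : IsSmoothConvexLoss L f) (t : ℕ) (S : Fin n → Z) (k : Fin n) :
    0 ≤ expSampleLoss Ω f η t S k :=
  integral_nonneg fun _ => hf.nonneg _ _

theorem integrable_comp_sgd (g : Param d → ℝ) (η : ℕ → ℝ) (S : Fin n → Z) (t : ℕ) :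
    Integrable (fun i => g (sgd Ω f η S i t)) (indexLaw n) :=
  integrable_indexLaw_of_dependsOn (t := t) fun _ _ hij =>
    congrArg g (dependsOn_sgd η S t hij)

theorem integrable_comp_sgd_sgd (g : Param d → Param d → ℝ) (η : ℕ → ℝ) (S S' : Fin n → Z)
    (t : ℕ) :
    Integrable (fun i => g (sgd Ω f η S i t) (sgd Ω f η S' i t)) (indexLaw n) :=
  integrable_indexLaw_of_dependsOn (t := t) fun _ _ hij =>
    congrArg₂ g (dependsOn_sgd η S t hij) (dependsOn_sgd η S' t hij)

theorem integrable_loss_sgd_index (η : ℕ → ℝ) (S : Fin n → Z) (t : ℕ) :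
    Integrable (fun i => f (sgd Ω f η S i t) (S (i t))) (indexLaw n) :=
  integrable_indexLaw_of_dependsOn (t := t + 1) fun i j hij => by
    have e : sgd Ω f η S i t = sgd Ω f η S j t :=
      dependsOn_sgd η S t fun s hs =>
        hij s (Set.mem_Iio.2 ((Set.mem_Iio.1 hs).trans t.lt_succ_self))
    simp only [e, hij t (Set.mem_Iio.2 t.lt_succ_self)]

theorem integral_loss_sgd_index (t : ℕ) (S : Fin n → Z) :
    ∫ i, f (sgd Ω f (fun _ => η) S i t) (S (i t)) ∂(indexLaw n)
      = (n : ℝ)⁻¹ * ∑ k, expSampleLoss Ω f η t S k :=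
  integral_indexLaw_eval (H := fun i k => f (sgd Ω f (fun _ => η) S i t) (S k))
    fun k _ _ hij => congrArg (fun w => f w (S k)) (dependsOn_sgd _ S t hij)

theorem integrable_comp_sgdAverage (g : Param d → ℝ) (η : ℕ → ℝ) (S : Fin n → Z) (T : ℕ) :
    Integrable (fun i => g (sgdAverage Ω f η S i T)) (indexLaw n) :=
  integrable_indexLaw_of_dependsOn (t := T) fun _ _ hij =>
    congrArg g (dependsOn_sgdAverage η S T hij)

theorem integrable_comp_sgdAverage_sgdAverage (g : Param d → Param d → ℝ) (η : ℕ → ℝ)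
    (S S' : Fin n → Z) (T : ℕ) :
    Integrable (fun i => g (sgdAverage Ω f η S i T) (sgdAverage Ω f η S' i T)) (indexLaw n) :=
  integrable_indexLaw_of_dependsOn (t := T) fun _ _ hij =>
    congrArg₂ g (dependsOn_sgdAverage η S T hij) (dependsOn_sgdAverage η S' T hij)

variable [MeasurableSpace Z] {ρ : Measure Z}

/-- The path inequality averaged over the indices: each loss at the drawn point becomes an empirical
mean over the sample. -/
theorem sum_expSampleLoss_le (h : SGDAssumptions L η Ω f ρ) {u : Param d} (hu : u ∈ Ω)
    (S : Fin n → Z) (T : ℕ) :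
    ∑ t ∈ Finset.range T, (n : ℝ)⁻¹ * ∑ k, expSampleLoss Ω f η t S k
      ≤ (1 + 2 * L * η) * (‖u‖ ^ 2 / (2 * η) + T * ((n : ℝ)⁻¹ * ∑ k, f u (S k))) := by
  have hη := h.step_pos
  have hL := h.smooth_pos
  have hLη : 0 < 1 - L * η := by linarith [h.step_le, mul_comm L η]
  have hfi : ∀ t, Integrable (fun i : ℕ → Fin n => f u (S (i t))) (indexLaw n) := fun t =>
    integrable_indexLaw_of_dependsOn (t := t + 1) fun i j hij => by
      simp only [hij t (Set.mem_Iio.2 t.lt_succ_self)]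
  have hfe : ∀ t, ∫ i, f u (S (i t)) ∂(indexLaw n) = (n : ℝ)⁻¹ * ∑ k, f u (S k) := by
    intro t
    rw [integral_indexLaw_eval (H := fun _ k => f u (S k)) fun k _ _ _ => rfl]
    simp
  have hmono := integral_mono (μ := indexLaw n)
    (f := fun i => 2 * η * (1 - L * η)
      * ∑ t ∈ Finset.range T, f (sgd Ω f (fun _ => η) S i t) (S (i t)))
    (g := fun i => ‖u‖ ^ 2 + 2 * η * ∑ t ∈ Finset.range T, f u (S (i t)))
    ((integrable_finsetSum _ fun t _ => integrable_loss_sgd_index _ S t).const_mul _)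
    ((integrable_const _).add ((integrable_finsetSum _ fun t _ => hfi t).const_mul _))
    fun i => by
      have := sq_norm_sgd_sub_add_sum_le h.loss hL hη h.nonempty h.isClosed h.convex hu S i T
      have h0 := sq_nonneg ‖sgd Ω f (fun _ => η) S i T - u‖
      dsimp only
      linarith
  rw [integral_const_mul, integral_finsetSum _ fun t _ => integrable_loss_sgd_index _ S t,
    integral_add (integrable_const _) ((integrable_finsetSum _ fun t _ => hfi t).const_mul _),
    integral_const_mul, integral_finsetSum _ fun t _ => hfi t] at hmono
  simp only [integral_loss_sgd_index, hfe, integral_const, probReal_univ, one_smul,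
    Finset.sum_const, Finset.card_range, nsmul_eq_mul] at hmono
  set V := ∑ t ∈ Finset.range T, (n : ℝ)⁻¹ * ∑ k, expSampleLoss Ω f η t S k
  set X := (T : ℝ) * ((n : ℝ)⁻¹ * ∑ k, f u (S k)) with hX
  have hX0 : 0 ≤ X := mul_nonneg (Nat.cast_nonneg _) (mul_nonneg (by positivity)
    (Finset.sum_nonneg fun k _ => h.loss.nonneg _ _))
  have h1 : (1 - L * η) * V ≤ ‖u‖ ^ 2 / (2 * η) + X := by
    rw [← mul_le_mul_iff_right₀ (by positivity : 0 < 2 * η)]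
    calc 2 * η * ((1 - L * η) * V) = 2 * η * (1 - L * η) * V := by ring
      _ ≤ ‖u‖ ^ 2 + 2 * η * X := hmono
      _ = _ := by field_simp
  -- With `x = L * η ≤ 1 / 2`, the product is `1 + x * (1 - 2 * x)`, so dividing by `1 - x` costs at
  -- most `1 + 2 * x`.
  have h2 : 1 ≤ (1 + 2 * L * η) * (1 - L * η) := by
    have : 0 ≤ L * η * (1 - 2 * (L * η)) :=
      mul_nonneg (by positivity) (by linarith [h.step_le, mul_comm L η])
    linarith
  have hV0 : 0 ≤ V := Finset.sum_nonneg fun t _ => mul_nonneg (by positivity)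
    (Finset.sum_nonneg fun k _ => expSampleLoss_nonneg h.loss _ _ _)
  calc V ≤ (1 + 2 * L * η) * (1 - L * η) * V := le_mul_of_one_le_left hV0 h2
    _ = (1 + 2 * L * η) * ((1 - L * η) * V) := by ring
    _ ≤ _ := by gcongr

/-- The extra terms of one step appear only when `k` is drawn, so in expectation they carry the
factor `1 / n`. -/
theorem integral_sq_norm_sgd_sub_update_succ_le (h : SGDAssumptions L η Ω f ρ) {p : ℝ}
    (hp : 0 < p) (S : Fin n → Z) (k : Fin n) (z : Z) (t : ℕ) :
    ∫ i, ‖sgd Ω f (fun _ => η) S i (t + 1)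
        - sgd Ω f (fun _ => η) (Function.update S k z) i (t + 1)‖ ^ 2 ∂(indexLaw n)
      ≤ (1 + p / n) * ∫ i, ‖sgd Ω f (fun _ => η) S i t
          - sgd Ω f (fun _ => η) (Function.update S k z) i t‖ ^ 2 ∂(indexLaw n)
        + (n : ℝ)⁻¹ * ((1 + p⁻¹) * (4 * L * η ^ 2)) * (expSampleLoss Ω f η t S k
          + expSampleLoss Ω f η t (Function.update S k z) k) := by
  set S' := Function.update S k z with hS'
  have hz : S' k = z := Function.update_self ..
  set H : (ℕ → Fin n) → Fin n → ℝ := fun i j => if j = k then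
      p * ‖sgd Ω f (fun _ => η) S i t - sgd Ω f (fun _ => η) S' i t‖ ^ 2
      + (1 + p⁻¹) * (4 * L * η ^ 2) * (f (sgd Ω f (fun _ => η) S i t) (S k)
        + f (sgd Ω f (fun _ => η) S' i t) z) else 0 with hHdef
  have hH : ∀ j, DependsOn (fun i => H i j) (Set.Iio t) := by
    intro j i i' hij
    have e1 := dependsOn_sgd (Ω := Ω) (f := f) (fun _ => η) S t hij
    have e2 := dependsOn_sgd (Ω := Ω) (f := f) (fun _ => η) S' t hij
    dsimp only at e1 e2
    simp only [hHdef, e1, e2]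
  have hHi : Integrable (fun i => H i (i t)) (indexLaw n) :=
    integrable_indexLaw_of_dependsOn (t := t + 1) fun i j hij => by
      have e : H i (i t) = H j (i t) := hH (i t) fun s hs =>
        hij s (Set.mem_Iio.2 ((Set.mem_Iio.1 hs).trans t.lt_succ_self))
      change H i (i t) = H j (j t)
      rw [e, hij t (Set.mem_Iio.2 t.lt_succ_self)]
  have hD := fun t => integrable_comp_sgd_sgd (n := n) (Ω := Ω) (f := f)
    (fun w v => ‖w - v‖ ^ 2) (fun _ => η) S S' t
  have hmono := integral_mono (hD (t + 1)) ((hD t).add hHi) fun i => by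
    have := sq_norm_sgd_succ_sub_sgd_update_succ_le h.loss h.smooth_pos h.step_pos
      (by linarith [h.step_le]) h.nonempty h.isClosed h.convex hp S k z i t
    simpa [H, ← hS'] using this
  have hl1 := integrable_comp_sgd (n := n) (Ω := Ω) (f := f)
    (fun w => f w (S k)) (fun _ => η) S t
  have hl2 := integrable_comp_sgd (n := n) (Ω := Ω) (f := f)
    (fun w => f w z) (fun _ => η) S' t
  have hl : Integrable (fun i => f (sgd Ω f (fun _ => η) S i t) (S k)
      + f (sgd Ω f (fun _ => η) S' i t) z) (indexLaw n) := hl1.add hl2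
  have hsum : ∑ j, ∫ i, H i j ∂(indexLaw n) = ∫ i, H i k ∂(indexLaw n) := by
    refine Finset.sum_eq_single k (fun j _ hj => ?_) (by simp)
    simp [H, hj]
  have hk : ∫ i, H i k ∂(indexLaw n)
      = p * ∫ i, ‖sgd Ω f (fun _ => η) S i t - sgd Ω f (fun _ => η) S' i t‖ ^ 2 ∂(indexLaw n)
        + (1 + p⁻¹) * (4 * L * η ^ 2) * (expSampleLoss Ω f η t S k
          + expSampleLoss Ω f η t S' k) := by
    simp only [H, if_true]
    rw [integral_add ((hD t).const_mul _) (hl.const_mul _), integral_const_mul,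
      integral_const_mul, integral_add hl1 hl2, expSampleLoss, expSampleLoss, hz]
  simp only [Pi.add_apply] at hmono
  rw [integral_add (hD t) hHi, integral_indexLaw_eval hH, hsum, hk] at hmono
  refine hmono.trans (le_of_eq ?_)
  ring

theorem integral_sq_norm_sgd_sub_update_le (h : SGDAssumptions L η Ω f ρ)
    (S : Fin n → Z) (k : Fin n) (z : Z) {t T : ℕ} (htT : t ≤ T) (hT : 0 < T) :
    ∫ i, ‖sgd Ω f (fun _ => η) S i t
        - sgd Ω f (fun _ => η) (Function.update S k z) i t‖ ^ 2 ∂(indexLaw n)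
      ≤ 3 * ((n : ℝ)⁻¹ * ((1 + T / n) * (4 * L * η ^ 2))) * ∑ s ∈ Finset.range T,
        (expSampleLoss Ω f η s S k + expSampleLoss Ω f η s (Function.update S k z) k) := by
  have hn : (0 : ℝ) < n := by exact_mod_cast Nat.pos_of_neZero n
  have hT' : (0 : ℝ) < T := by exact_mod_cast hT
  have hL := h.smooth_pos
  -- The choice `p = n / T` makes the growth factor `1 + p / n` equal to `1 + 1 / T`, and `1 + p⁻¹`
  -- equal to `1 + T / n`.
  have hp : (0 : ℝ) < n / T := by positivity
  set c := (n : ℝ)⁻¹ * ((1 + T / n) * (4 * L * η ^ 2)) with hc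
  have hc0 : 0 ≤ c := by positivity
  set e : ℕ → ℝ := fun s =>
    expSampleLoss Ω f η s S k + expSampleLoss Ω f η s (Function.update S k z) k with he
  have he0 : ∀ s, 0 ≤ e s := fun s =>
    add_nonneg (expSampleLoss_nonneg h.loss _ _ _) (expSampleLoss_nonneg h.loss _ _ _)
  have h1 := le_pow_mul_sum_of_succ_le
    (D := fun t => ∫ i, ‖sgd Ω f (fun _ => η) S i t
        - sgd Ω f (fun _ => η) (Function.update S k z) i t‖ ^ 2 ∂(indexLaw n))
    (b := fun s => c * e s) (q := 1 + 1 / T) (by simp)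
    (fun s => mul_nonneg hc0 (he0 s)) (by simp [sgd]) (fun s => by
      have := integral_sq_norm_sgd_sub_update_succ_le h hp S k z s
      rwa [inv_div, div_div_cancel_left' hn.ne', ← one_div] at this) t
  refine h1.trans ?_
  rw [← Finset.mul_sum, ← mul_assoc]
  have h2 : (1 + 1 / (T : ℝ)) ^ t ≤ 3 := by
    calc (1 + 1 / (T : ℝ)) ^ t ≤ (1 + 1 / (T : ℝ)) ^ T :=
          pow_le_pow_right₀ (by simp) htT
      _ ≤ Real.exp (1 / T) ^ T := by
          gcongr
          linarith [Real.add_one_le_exp (1 / (T : ℝ))]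
      _ = Real.exp 1 := by rw [← Real.exp_nat_mul, mul_one_div_cancel hT'.ne']
      _ ≤ 3 := Real.exp_one_lt_three.le
  have h3 : ∑ s ∈ Finset.range t, e s ≤ ∑ s ∈ Finset.range T, e s :=
    Finset.sum_le_sum_of_subset_of_nonneg (Finset.range_mono htT) fun s _ _ => he0 s
  have h4 : 0 ≤ ∑ s ∈ Finset.range t, e s := Finset.sum_nonneg fun s _ => he0 s
  gcongr

theorem integral_sq_norm_sgdAverage_sub_update_le (h : SGDAssumptions L η Ω f ρ)
    (S : Fin n → Z) (k : Fin n) (z : Z) {T : ℕ} (hT : 0 < T) :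
    ∫ i, ‖sgdAverage Ω f (fun _ => η) (Function.update S k z) i T
        - sgdAverage Ω f (fun _ => η) S i T‖ ^ 2 ∂(indexLaw n)
      ≤ 3 * ((n : ℝ)⁻¹ * ((1 + T / n) * (4 * L * η ^ 2))) * ∑ s ∈ Finset.range T,
        (expSampleLoss Ω f η s S k + expSampleLoss Ω f η s (Function.update S k z) k) := by
  set S' := Function.update S k z with hS'
  have hT' : (0 : ℝ) < T := by exact_mod_cast hT
  have hD := fun t => integrable_comp_sgd_sgd (n := n) (Ω := Ω) (f := f)
    (fun w v => ‖w - v‖ ^ 2) (fun _ => η) S S' t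
  have hmono := integral_mono
    (integrable_comp_sgdAverage_sgdAverage (n := n) (Ω := Ω) (f := f)
      (fun w v => ‖w - v‖ ^ 2) (fun _ => η) S' S T)
    ((integrable_finsetSum (Finset.range T) fun t _ => hD t).const_mul (T : ℝ)⁻¹) fun i => by
      dsimp only
      rw [norm_sub_rev, sgdAverage_const h.step_pos, sgdAverage_const h.step_pos,
        average_sub_average]
      exact sq_norm_average_le hT _
  refine hmono.trans ?_
  rw [integral_const_mul, integral_finsetSum _ fun t _ => hD t, inv_mul_le_iff₀ hT']
  refine (Finset.sum_le_card_nsmul _ _ _ fun t ht =>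
    integral_sq_norm_sgd_sub_update_le h S k z (Finset.mem_range.1 ht).le hT).trans ?_
  rw [Finset.card_range, nsmul_eq_mul]

theorem integral_loss_sgdAverage_le (h : SGDAssumptions L η Ω f ρ)
    (S : Fin n → Z) (k : Fin n) {T : ℕ} (hT : 0 < T) :
    ∫ i, f (sgdAverage Ω f (fun _ => η) S i T) (S k) ∂(indexLaw n)
      ≤ (T : ℝ)⁻¹ * ∑ t ∈ Finset.range T, expSampleLoss Ω f η t S k := by
  have hD := fun t => integrable_comp_sgd (n := n) (Ω := Ω) (f := f)
    (fun w => f w (S k)) (fun _ => η) S t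
  refine (integral_mono
    (integrable_comp_sgdAverage (n := n) (Ω := Ω) (f := f)
      (fun w => f w (S k)) (fun _ => η) S T)
    ((integrable_finsetSum (Finset.range T) fun t _ => hD t).const_mul (T : ℝ)⁻¹)
    fun i => ?_).trans (le_of_eq ?_)
  · dsimp only
    rw [sgdAverage_const h.step_pos]
    exact (h.loss.convex (S k)).map_inv_smul_sum_range_le hT _
  · rw [integral_const_mul, integral_finsetSum _ fun t _ => hD t]
    rfl

/-- The loss of the run on the perturbed sample at the point that was replaced. -/
theorem integral_loss_sgdAverage_update_le (h : SGDAssumptions L η Ω f ρ) {γ : ℝ} (hγ : 0 < γ)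
    (S : Fin n → Z) (k : Fin n) (z : Z) {T : ℕ} (hT : 0 < T) :
    ∫ i, f (sgdAverage Ω f (fun _ => η) (Function.update S k z) i T) (S k) ∂(indexLaw n)
      ≤ (1 + L / γ) * ((T : ℝ)⁻¹ * ∑ t ∈ Finset.range T, expSampleLoss Ω f η t S k)
        + (L + γ) / 2 * (3 * ((n : ℝ)⁻¹ * ((1 + T / n) * (4 * L * η ^ 2)))
          * ∑ s ∈ Finset.range T,
            (expSampleLoss Ω f η s S k + expSampleLoss Ω f η s (Function.update S k z) k)) := by
  have hL := h.smooth_pos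
  have h1 := integrable_comp_sgdAverage (n := n) (Ω := Ω) (f := f)
      (fun w => f w (S k)) (fun _ => η) S T
  have h2 := integrable_comp_sgdAverage_sgdAverage (n := n) (Ω := Ω) (f := f)
      (fun w v => ‖w - v‖ ^ 2) (fun _ => η) (Function.update S k z) S T
  refine (integral_mono
    (integrable_comp_sgdAverage (n := n) (Ω := Ω) (f := f)
      (fun w => f w (S k)) (fun _ => η) (Function.update S k z) T)
    ((h1.const_mul (1 + L / γ)).add (h2.const_mul ((L + γ) / 2)))
    fun i => le_mul_add_sq_norm_sub hL hγ (h.loss.differentiable (S k)) (h.loss.smooth (S k))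
      (fun w => h.loss.nonneg w (S k)) _ _).trans ?_
  simp only [Pi.add_apply]
  rw [integral_add (h1.const_mul _) (h2.const_mul _), integral_const_mul, integral_const_mul]
  gcongr
  · exact integral_loss_sgdAverage_le h S k hT
  · exact integral_sq_norm_sgdAverage_sub_update_le h S k z hT

end FixedSample

/-! ### Expectation over the sample: integrability, the exchange argument and the risk bound. -/

section RandomSample

variable {d n : ℕ} {Z : Type*} [MeasurableSpace Z] {L η : ℝ} {Ω : Set (Param d)}
  {f : Param d → Z → ℝ} {ρ : Measure Z}

/-- The case `γ = L` of `le_mul_add_sq_norm_sub`; it supplies the dominating functions for all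
integrability claims. -/
theorem loss_le_of_sq_norm_sub_le (h : SGDAssumptions L η Ω f ρ) {u w : Param d} {B : ℝ}
    (hB : ‖w - u‖ ^ 2 ≤ B) (z : Z) : f w z ≤ 2 * f u z + L * B := by
  have hL := h.smooth_pos
  have h1 := le_mul_add_sq_norm_sub hL hL (h.loss.differentiable z) (h.loss.smooth z)
    (fun w => h.loss.nonneg w z) w u
  rw [div_self hL.ne'] at h1
  nlinarith [mul_le_mul_of_nonneg_left hB hL.le]

/-- A bound on the squared distance of the first `T` iterates to `u` that holds for all indices. -/
noncomputable def sampleBound (f : Param d → Z → ℝ) (η : ℝ) (u : Param d) (T : ℕ) (S : Fin n → Z) : ℝ :=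
  ‖u‖ ^ 2 + 2 * η * (T * ∑ k, f u (S k))

theorem loss_sgd_le (h : SGDAssumptions L η Ω f ρ) {u : Param d} (hu : u ∈ Ω) (S : Fin n → Z)
    (i : ℕ → Fin n) (t : ℕ) (z : Z) :
    f (sgd Ω f (fun _ => η) S i t) z ≤ 2 * f u z + L * sampleBound f η u t S :=
  loss_le_of_sq_norm_sub_le h (sq_norm_sgd_sub_le h.loss h.smooth_pos h.step_pos
    (by linarith [h.step_le]) h.nonempty h.isClosed h.convex hu S i t) z

theorem loss_sgdAverage_le (h : SGDAssumptions L η Ω f ρ) {u : Param d} (hu : u ∈ Ω)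
    (S : Fin n → Z) (i : ℕ → Fin n) {T : ℕ} (hT : 0 < T) (z : Z) :
    f (sgdAverage Ω f (fun _ => η) S i T) z ≤ 2 * f u z + L * sampleBound f η u T S :=
  loss_le_of_sq_norm_sub_le h (sq_norm_sgdAverage_sub_le h.loss h.smooth_pos h.step_pos
    (by linarith [h.step_le]) h.nonempty h.isClosed h.convex hu S i hT) z

theorem popRisk_nonneg (h : SGDAssumptions L η Ω f ρ) (w : Param d) : 0 ≤ popRisk ρ f w :=
  integral_nonneg fun z => h.loss.nonneg w z

variable [IsProbabilityMeasure ρ]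

theorem popRisk_sgdAverage_le (h : SGDAssumptions L η Ω f ρ) {u : Param d} (hu : u ∈ Ω)
    (S : Fin n → Z) (i : ℕ → Fin n) {T : ℕ} (hT : 0 < T) :
    popRisk ρ f (sgdAverage Ω f (fun _ => η) S i T)
      ≤ 2 * popRisk ρ f u + L * sampleBound f η u T S := by
  have h1 := integral_mono (h.integrable (sgdAverage Ω f (fun _ => η) S i T))
    (((h.integrable u).const_mul 2).add (integrable_const (L * sampleBound f η u T S)))
    fun z => loss_sgdAverage_le h hu S i hT z
  simp only [Pi.add_apply] at h1
  rw [integral_add ((h.integrable u).const_mul 2) (integrable_const _), integral_const_mul] at h1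
  simpa [popRisk] using h1

theorem measurable_popRisk (h : SGDAssumptions L η Ω f ρ) : Measurable (popRisk ρ f) :=
  (measurable_uncurry_loss h.measurable h.loss).stronglyMeasurable.integral_prod_right'.measurable

/-- The average misses the domain by at most `O(1 / T)`, so its risk is almost minimal at least. -/
theorem popRisk_sub_le_popRisk_sgdAverage (h : SGDAssumptions L η Ω f ρ) {u : Param d}
    (hu : u ∈ Ω) (hmin : ∀ w ∈ Ω, popRisk ρ f u ≤ popRisk ρ f w) (S : Fin n → Z)
    (i : ℕ → Fin n) {T : ℕ} (hT : 0 < T) :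
    popRisk ρ f u - (popRisk ρ f u + L * ‖u‖ ^ 2) / T
      ≤ popRisk ρ f (sgdAverage Ω f (fun _ => η) S i T) := by
  have hL := h.smooth_pos
  have hT' : (0 : ℝ) < T := by exact_mod_cast hT
  have hT1 : (1 : ℝ) ≤ T := by exact_mod_cast hT
  have hu0 := popRisk_nonneg h u
  rw [sgdAverage_const h.step_pos]
  set W := sgd Ω f (fun _ => η) S i
  set w := (T : ℝ)⁻¹ • ∑ t ∈ Finset.range T, W t with hw
  -- Only the initial iterate `0` may lie outside `Ω`; replacing it by `u` moves the average by `u /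
  -- T` and puts it into `Ω`.
  set x : ℕ → Param d := fun t => W t + if t = 0 then u else 0
  have hx : ∀ t, x t ∈ Ω := by
    intro t
    cases t with
    | zero => simpa [x, W, sgd] using hu
    | succ t =>
      simpa [x, W, sgd] using (projOn_spec h.nonempty h.isClosed h.convex _).1.1
  set v := (T : ℝ)⁻¹ • ∑ t ∈ Finset.range T, x t with hv
  have hvΩ : v ∈ Ω := by
    rw [hv, Finset.smul_sum]
    exact h.convex.sum_mem (fun _ _ => by positivity) (by simp [hT'.ne']) fun t _ => hx t
  have hvw : v - w = (T : ℝ)⁻¹ • u := by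
    rw [hv, hw, average_sub_average]
    simp [x, hT]
  have hpt : ∀ z, f v z ≤ (1 + 1 / T) * f w z + L * ‖u‖ ^ 2 / T := by
    intro z
    -- The choice `γ = L * T` makes the multiplicative loss `1 + 1 / T`, while the squared distance
    -- `‖u‖ ^ 2 / T ^ 2` leaves an error of at most `L * ‖u‖ ^ 2 / T`.
    have h1 := le_mul_add_sq_norm_sub hL (mul_pos hL hT') (h.loss.differentiable z)
      (h.loss.smooth z) (fun w => h.loss.nonneg w z) v w
    have e : L / (L * T) = 1 / T := by field_simp
    rw [hvw, norm_smul, Real.norm_of_nonneg (inv_nonneg.2 hT'.le), e] at h1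
    have h2 : (L + L * T) / 2 * ((T : ℝ)⁻¹ * ‖u‖) ^ 2 ≤ L * ‖u‖ ^ 2 / T := by
      have h3 : (L + L * T) / 2 * ((T : ℝ)⁻¹ * ‖u‖) ^ 2
          = (1 + T) / 2 * (L * ‖u‖ ^ 2 / T ^ 2) := by
        field_simp
      have h4 : L * ‖u‖ ^ 2 / T = T * (L * ‖u‖ ^ 2 / T ^ 2) := by
        field_simp
      rw [h3, h4]
      gcongr
      linarith
    linarith
  have hint := integral_mono (h.integrable v)
    (((h.integrable w).const_mul (1 + 1 / (T : ℝ))).add (integrable_const _)) hpt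
  rw [integral_add' ((h.integrable w).const_mul _) (integrable_const _), integral_const_mul,
    integral_const, probReal_univ, one_smul] at hint
  change popRisk ρ f v ≤ (1 + 1 / T) * popRisk ρ f w + _ at hint
  have h5 := hmin v hvΩ
  have e : (popRisk ρ f u + L * ‖u‖ ^ 2) / T
      = 1 / T * popRisk ρ f u + L * ‖u‖ ^ 2 / T := by ring
  rw [e]
  have h6 : 0 ≤ L * ‖u‖ ^ 2 / T := by positivity
  have h7 : (0 : ℝ) < 1 / T := by positivity
  -- If the bound failed, the risk at `w` would be below that at `u`, so the excess term `1 / T *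
  -- popRisk ρ f w` could be replaced by its value at `u`.
  by_contra! hlt
  have h8 : popRisk ρ f w ≤ popRisk ρ f u := by
    have : 0 ≤ 1 / T * popRisk ρ f u := by positivity
    linarith
  have h9 := mul_le_mul_of_nonneg_left h8 h7.le
  linarith

theorem integrable_loss_sample_apply (h : SGDAssumptions L η Ω f ρ) (u : Param d) (k : Fin n) :
    Integrable (fun S : Fin n → Z => f u (S k)) (Measure.pi fun _ => ρ) :=
  (measurePreserving_eval (fun _ : Fin n => ρ) k).integrable_comp_of_integrable (h.integrable u)

theorem integral_loss_sample_apply (h : SGDAssumptions L η Ω f ρ) (u : Param d) (k : Fin n) :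
    ∫ S : Fin n → Z, f u (S k) ∂(Measure.pi fun _ => ρ) = popRisk ρ f u := by
  have h1 := measurePreserving_eval (fun _ : Fin n => ρ) k
  have h2 := integral_map (μ := Measure.pi fun _ : Fin n => ρ) h1.measurable.aemeasurable
    (h.measurable u).aestronglyMeasurable
  rw [h1.map_eq] at h2
  exact h2.symm

theorem integrable_sampleBound (h : SGDAssumptions L η Ω f ρ) (u : Param d) (T : ℕ) :
    Integrable (sampleBound (n := n) f η u T) (Measure.pi fun _ => ρ) :=
  (integrable_const _).add (((integrable_finsetSum _ fun k _ =>
    integrable_loss_sample_apply h u k).const_mul _).const_mul _)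

variable [NeZero n]

instance isProbabilityMeasure_sampleIndexLaw : IsProbabilityMeasure (sampleIndexLaw ρ n) :=
  inferInstanceAs (IsProbabilityMeasure ((Measure.pi fun _ : Fin n => ρ).prod (indexLaw n)))

theorem integrable_popRisk_sgdAverage (h : SGDAssumptions L η Ω f ρ) {T : ℕ} (hT : 0 < T) :
    Integrable (fun p => popRisk ρ f (sgdAverage Ω f (fun _ => η) p.1 p.2 T))
      (sampleIndexLaw ρ n) := by
  obtain ⟨u, hu⟩ := h.nonempty
  have hb : Integrable (fun p : (Fin n → Z) × (ℕ → Fin n) =>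
      2 * popRisk ρ f u + L * sampleBound f η u T p.1) (sampleIndexLaw ρ n) :=
    (integrable_const _).add (((integrable_sampleBound h u T).comp_fst _).const_mul L)
  refine hb.mono' ((measurable_popRisk h).comp (measurable_sgdAverage h.measurable h.loss
    h.nonempty h.isClosed h.convex _ T)).aestronglyMeasurable (Filter.Eventually.of_forall ?_)
  intro p
  rw [Real.norm_of_nonneg (popRisk_nonneg h _)]
  exact popRisk_sgdAverage_le h hu p.1 p.2 hT

theorem integrable_expSampleLoss (h : SGDAssumptions L η Ω f ρ) (t : ℕ) (k : Fin n) :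
    Integrable (fun S : Fin n → Z => expSampleLoss Ω f η t S k) (Measure.pi fun _ => ρ) := by
  obtain ⟨u, hu⟩ := h.nonempty
  have hb : Integrable (fun S : Fin n → Z => 2 * f u (S k) + L * sampleBound f η u t S)
      (Measure.pi fun _ => ρ) :=
    ((integrable_loss_sample_apply h u k).const_mul 2).add
      ((integrable_sampleBound h u t).const_mul L)
  refine hb.mono' ?_ (Filter.Eventually.of_forall fun S => ?_)
  · have hm : Measurable fun p : (Fin n → Z) × (ℕ → Fin n) =>
        f (sgd Ω f (fun _ => η) p.1 p.2 t) (p.1 k) :=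
      (measurable_uncurry_loss h.measurable h.loss).comp ((measurable_sgd h.measurable h.loss
        h.nonempty h.isClosed h.convex _ t).prodMk ((measurable_pi_apply k).comp measurable_fst))
    exact hm.stronglyMeasurable.integral_prod_right'.aestronglyMeasurable
  · rw [Real.norm_of_nonneg (expSampleLoss_nonneg h.loss t S k)]
    refine (integral_mono (integrable_comp_sgd (fun w => f w (S k)) _ S t) (integrable_const _)
      fun i => loss_sgd_le h hu S i t (S k)).trans ?_
    simp

theorem sum_integral_expSampleLoss_le (h : SGDAssumptions L η Ω f ρ) {u : Param d} (hu : u ∈ Ω)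
    (T : ℕ) :
    (n : ℝ)⁻¹ * ∑ k : Fin n, ∑ t ∈ Finset.range T,
        ∫ S : Fin n → Z, expSampleLoss Ω f η t S k ∂(Measure.pi fun _ => ρ)
      ≤ (1 + 2 * L * η) * (‖u‖ ^ 2 / (2 * η) + T * popRisk ρ f u) := by
  have hn : (n : ℝ) ≠ 0 := by exact_mod_cast NeZero.ne n
  have hφ := fun t k => integrable_expSampleLoss (n := n) h t k
  have hu' := fun k => integrable_loss_sample_apply (n := n) h u k
  have hr : Integrable (fun S : Fin n → Z => (T : ℝ) * ((n : ℝ)⁻¹ * ∑ k, f u (S k)))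
      (Measure.pi fun _ => ρ) :=
    ((integrable_finsetSum _ fun k _ => hu' k).const_mul _).const_mul _
  have hmono := integral_mono
    (integrable_finsetSum (Finset.range T) fun t _ =>
      (integrable_finsetSum Finset.univ fun k _ => hφ t k).const_mul (n : ℝ)⁻¹)
    (((integrable_const (‖u‖ ^ 2 / (2 * η))).add hr).const_mul (1 + 2 * L * η))
    fun S => sum_expSampleLoss_le h hu S T
  simp only [Pi.add_apply] at hmono
  rw [integral_finsetSum _ fun t _ =>
      (integrable_finsetSum Finset.univ fun k _ => hφ t k).const_mul (n : ℝ)⁻¹,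
    integral_const_mul, integral_add (integrable_const _) hr, integral_const_mul,
    integral_const_mul, integral_finsetSum _ fun k _ => hu' k] at hmono
  simp only [integral_const_mul, integral_finsetSum _ fun k _ => hφ _ k,
    integral_loss_sample_apply h, integral_const, probReal_univ, one_smul, Finset.sum_const,
    Finset.card_univ, Fintype.card_fin, nsmul_eq_mul, inv_mul_cancel_left₀ hn] at hmono
  rwa [← Finset.mul_sum, Finset.sum_comm] at hmono

/-- The replaced point `q.1 k` is independent of the perturbed sample, so it acts as a fresh test
point for the run on that sample. -/
theorem integral_popRisk_sgdAverage_eq (h : SGDAssumptions L η Ω f ρ) {T : ℕ} (hT : 0 < T)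
    (k : Fin n) :
    Integrable (fun q : (Fin n → Z) × Z => ∫ i, f (sgdAverage Ω f (fun _ => η)
      (Function.update q.1 k q.2) i T) (q.1 k) ∂(indexLaw n))
      ((Measure.pi fun _ => ρ).prod ρ) ∧
    ∫ p, popRisk ρ f (sgdAverage Ω f (fun _ => η) p.1 p.2 T) ∂(sampleIndexLaw ρ n)
      = ∫ q : (Fin n → Z) × Z, ∫ i, f (sgdAverage Ω f (fun _ => η)
        (Function.update q.1 k q.2) i T) (q.1 k) ∂(indexLaw n)
        ∂((Measure.pi fun _ => ρ).prod ρ) := by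
  obtain ⟨u, hu⟩ := h.nonempty
  have hav := measurable_sgdAverage (n := n) h.measurable h.loss h.nonempty h.isClosed h.convex
    (fun _ => η) T
  have hm : Measurable fun r : ((Fin n → Z) × Z) × (ℕ → Fin n) =>
      f (sgdAverage Ω f (fun _ => η) r.1.1 r.2 T) r.1.2 :=
    (measurable_uncurry_loss h.measurable h.loss).comp ((hav.comp
      ((measurable_fst.comp measurable_fst).prodMk measurable_snd)).prodMk
        (measurable_snd.comp measurable_fst))
  -- The loss of the run on `q.1` at the test point `q.2`. Fubini identifies its integral with the
  -- expected risk; composing it with the exchange gives the right-hand side.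
  set Ψ : (Fin n → Z) × Z → ℝ := fun q =>
    ∫ i, f (sgdAverage Ω f (fun _ => η) q.1 i T) q.2 ∂(indexLaw n) with hΨ
  have hΨm : StronglyMeasurable Ψ := hm.stronglyMeasurable.integral_prod_right'
  have hΨi : Integrable Ψ ((Measure.pi fun _ => ρ).prod ρ) := by
    have hb : Integrable (fun q : (Fin n → Z) × Z => 2 * f u q.2 + L * sampleBound f η u T q.1)
        ((Measure.pi fun _ => ρ).prod ρ) :=
      (((h.integrable u).comp_snd _).const_mul 2).add
        (((integrable_sampleBound h u T).comp_fst _).const_mul L)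
    refine hb.mono' hΨm.aestronglyMeasurable (Filter.Eventually.of_forall fun q => ?_)
    rw [Real.norm_of_nonneg (integral_nonneg fun i => h.loss.nonneg _ _)]
    refine (integral_mono (integrable_comp_sgdAverage (fun w => f w q.2) _ q.1 T)
      (integrable_const _) fun i => loss_sgdAverage_le h hu q.1 i hT q.2).trans ?_
    simp
  have hex := measurePreserving_update_prod ρ k
  refine ⟨hex.integrable_comp_of_integrable hΨi, ?_⟩
  have e1 : ∫ q, Ψ (Function.update q.1 k q.2, q.1 k) ∂((Measure.pi fun _ => ρ).prod ρ)
      = ∫ q, Ψ q ∂((Measure.pi fun _ => ρ).prod ρ) := by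
    conv_rhs => rw [← hex.map_eq]
    exact (integral_map hex.measurable.aemeasurable hΨm.aestronglyMeasurable).symm
  have e2 : ∫ p, popRisk ρ f (sgdAverage Ω f (fun _ => η) p.1 p.2 T) ∂(sampleIndexLaw ρ n)
      = ∫ S : Fin n → Z, ∫ i, popRisk ρ f (sgdAverage Ω f (fun _ => η) S i T) ∂(indexLaw n)
        ∂(Measure.pi fun _ => ρ) :=
    integral_prod _ (integrable_popRisk_sgdAverage h hT)
  refine Eq.trans ?_ e1.symm
  rw [e2, integral_prod _ hΨi]
  refine integral_congr_ae (Filter.Eventually.of_forall fun S => ?_)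
  refine integral_integral_swap (f := fun i z => f (sgdAverage Ω f (fun _ => η) S i T) z) ?_
  have hb : Integrable (fun q : (ℕ → Fin n) × Z => 2 * f u q.2 + L * sampleBound f η u T S)
      ((indexLaw n).prod ρ) :=
    (((h.integrable u).comp_snd _).const_mul 2).add (integrable_const _)
  have hmS : Measurable fun q : (ℕ → Fin n) × Z =>
      f (sgdAverage Ω f (fun _ => η) S q.1 T) q.2 :=
    (measurable_uncurry_loss h.measurable h.loss).comp
      ((hav.comp (measurable_prodMk_left.comp measurable_fst)).prodMk measurable_snd)
  refine hb.mono' hmS.aestronglyMeasurable (Filter.Eventually.of_forall fun q => ?_)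
  rw [Function.uncurry_apply_pair, Real.norm_of_nonneg (h.loss.nonneg _ _)]
  exact loss_sgdAverage_le h hu S q.1 hT q.2

/-- The excess risk bound, with a free parameter `γ`. -/
theorem integral_popRisk_sgdAverage_le (h : SGDAssumptions L η Ω f ρ) {u : Param d} (hu : u ∈ Ω)
    {γ : ℝ} (hγ : 0 < γ) {T : ℕ} (hT : 0 < T) :
    ∫ p, popRisk ρ f (sgdAverage Ω f (fun _ => η) p.1 p.2 T) ∂(sampleIndexLaw ρ n)
      ≤ ((1 + L / γ) * (T : ℝ)⁻¹
          + (L + γ) * (3 * ((n : ℝ)⁻¹ * ((1 + T / n) * (4 * L * η ^ 2)))))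
        * ((1 + 2 * L * η) * (‖u‖ ^ 2 / (2 * η) + T * popRisk ρ f u)) := by
  have hL := h.smooth_pos
  have hn : (n : ℝ) ≠ 0 := by exact_mod_cast NeZero.ne n
  set K := 3 * ((n : ℝ)⁻¹ * ((1 + T / n) * (4 * L * η ^ 2))) with hK
  set E := ∫ p, popRisk ρ f (sgdAverage Ω f (fun _ => η) p.1 p.2 T) ∂(sampleIndexLaw ρ n)
  set Φ : Fin n → ℝ := fun k => ∑ t ∈ Finset.range T,
    ∫ S : Fin n → Z, expSampleLoss Ω f η t S k ∂(Measure.pi fun _ => ρ) with hΦ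
  -- The left side does not depend on `k`, so the bound may be averaged over `k` at the end, which
  -- is where the optimization bound applies.
  have hk : ∀ k, E ≤ ((1 + L / γ) * (T : ℝ)⁻¹ + (L + γ) * K) * Φ k := by
    intro k
    obtain ⟨hi, he⟩ := integral_popRisk_sgdAverage_eq h hT k
    have hex := measurePreserving_update_prod ρ k
    have hφ : ∀ t, Integrable (fun q : (Fin n → Z) × Z => expSampleLoss Ω f η t q.1 k)
        ((Measure.pi fun _ => ρ).prod ρ) := fun t =>
      (integrable_expSampleLoss h t k).comp_fst _
    have hφ' : ∀ t, Integrable (fun q : (Fin n → Z) × Z =>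
        expSampleLoss Ω f η t (Function.update q.1 k q.2) k)
        ((Measure.pi fun _ => ρ).prod ρ) := fun t =>
      hex.integrable_comp_of_integrable (hφ t)
    have iφ : ∀ t, ∫ q : (Fin n → Z) × Z, expSampleLoss Ω f η t q.1 k
        ∂((Measure.pi fun _ => ρ).prod ρ)
        = ∫ S : Fin n → Z, expSampleLoss Ω f η t S k ∂(Measure.pi fun _ => ρ) := by
      intro t
      rw [integral_prod _ (hφ t)]
      simp
    have iφ' : ∀ t, ∫ q : (Fin n → Z) × Z, expSampleLoss Ω f η t (Function.update q.1 k q.2) k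
        ∂((Measure.pi fun _ => ρ).prod ρ)
        = ∫ S : Fin n → Z, expSampleLoss Ω f η t S k ∂(Measure.pi fun _ => ρ) := by
      intro t
      rw [← iφ t]
      conv_rhs => rw [← hex.map_eq]
      refine (integral_map hex.measurable.aemeasurable
        (f := fun q : (Fin n → Z) × Z => expSampleLoss Ω f η t q.1 k) ?_).symm
      rw [hex.map_eq]
      exact (hφ t).aestronglyMeasurable
    have hA := ((integrable_finsetSum (Finset.range T) fun t _ => hφ t).const_mul
      (T : ℝ)⁻¹).const_mul (1 + L / γ)
    have hB := ((integrable_finsetSum (Finset.range T) fun t _ => (hφ t).add (hφ' t)).const_mul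
      K).const_mul ((L + γ) / 2)
    have hmono := integral_mono hi (hA.add hB) fun q =>
      integral_loss_sgdAverage_update_le h hγ q.1 k q.2 hT
    rw [← he] at hmono
    refine hmono.trans (le_of_eq ?_)
    rw [integral_add' hA hB, integral_const_mul, integral_const_mul, integral_const_mul,
      integral_const_mul, integral_finsetSum _ fun t _ => hφ t,
      integral_finsetSum _ fun t _ => (hφ t).add (hφ' t)]
    -- Original and perturbed losses have the same expectation; the resulting factor `2` cancels the
    -- `1 / 2` in `(L + γ) / 2`.
    simp only [integral_add' (hφ _) (hφ' _), iφ, iφ', ← two_mul, ← Finset.mul_sum]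
    rw [hΦ]
    ring
  have hc : 0 ≤ (1 + L / γ) * (T : ℝ)⁻¹ + (L + γ) * K := by
    have := h.step_pos
    positivity
  have hsum : E ≤ (n : ℝ)⁻¹ * ∑ k, ((1 + L / γ) * (T : ℝ)⁻¹ + (L + γ) * K) * Φ k := by
    calc E = (n : ℝ)⁻¹ * ∑ _k : Fin n, E := by simp [hn]
      _ ≤ _ := by
        refine mul_le_mul_of_nonneg_left (Finset.sum_le_sum fun k _ => hk k) (by positivity)
  refine hsum.trans ?_
  rw [← Finset.mul_sum, mul_left_comm]
  exact mul_le_mul_of_nonneg_left (sum_integral_expSampleLoss_le h hu T) hc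

end RandomSample

/-! ### Choice of `γ` and explicit rates. -/

section Rates

theorem one_add_mul_mul_le {F A B D x : ℝ} (hF : 0 ≤ F) (hA : 0 ≤ A) (hB : 0 ≤ B) (hD : 0 ≤ D)
    (hx0 : 0 ≤ x) (hx1 : x ≤ 1) :
    (1 + A * x) * ((1 + D * x) * (B * x + F))
      ≤ F + (B + (A + D + A * D) + (A + D + A * D) * B) * ((F + 1) * x) := by
  have hM : 0 ≤ A + D + A * D := by positivity
  have hxx : x * x ≤ x := mul_le_of_le_one_left hx0 hx1
  have h1 : (1 + A * x) * (1 + D * x) ≤ 1 + (A + D + A * D) * x := by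
    have : A * D * (x * x) ≤ A * D * x := mul_le_mul_of_nonneg_left hxx (by positivity)
    linarith
  have h2 : (A + D + A * D) * B * (x * x) ≤ (A + D + A * D) * B * x :=
    mul_le_mul_of_nonneg_left hxx (by positivity)
  set M := A + D + A * D
  calc (1 + A * x) * ((1 + D * x) * (B * x + F))
      = (1 + A * x) * (1 + D * x) * (B * x + F) := by ring
    _ ≤ (1 + M * x) * (B * x + F) := by gcongr
    _ = F + (B * x + M * F * x + M * B * (x * x)) := by ring
    _ ≤ F + (B * x + M * F * x + M * B * x) := by linarith
    _ ≤ F + (B + M + M * B) * ((F + 1) * x) := by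
      have h3 : 0 ≤ (B + M * B) * F * x := by positivity
      have h4 : 0 ≤ M * x := by positivity
      linarith

/-- The constant in the rate of SGD with step size `c / √T`. -/
noncomputable def rateConstant (L c R a b : ℝ) : ℝ :=
  let A := L + 12 * L * (L + 1) * (1 + 1 / a) * c ^ 2
  let B := R ^ 2 * √b / (2 * c)
  let D := 2 * L * c * √b
  B + (A + D + A * D) + (A + D + A * D) * B

theorem rateConstant_nonneg {L c R a b : ℝ} (hL : 0 < L) (hc : 0 < c) (ha : 0 < a) (hb : 0 < b) :
    0 ≤ rateConstant L c R a b := by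
  unfold rateConstant
  positivity

theorem risk_bound_le_rate {L c R a b F r n T : ℝ} (hL : 0 < L) (hc : 0 < c) (ha : 0 < a)
    (hb : 0 < b) (hF : 0 ≤ F) (hr : 0 ≤ r) (hR : r ≤ R) (hn : 1 ≤ n) (hT : 0 < T)
    (haT : a * T ≤ n) (hbT : n ≤ b * T) :
    ((1 + L / √n) * T⁻¹ + (L + √n) * (3 * (n⁻¹ * ((1 + T / n) * (4 * L * (c / √T) ^ 2)))))
        * ((1 + 2 * L * (c / √T)) * (r ^ 2 / (2 * (c / √T)) + T * F))
      ≤ F + rateConstant L c R a b * ((F + 1) / √n) := by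
  have hn0 : 0 < n := by linarith
  have hN1 : 1 ≤ √n := Real.one_le_sqrt.2 hn
  have hs0 : 0 < √T := Real.sqrt_pos.2 hT
  have hNs : √n ≤ √b * √T := by
    rw [← Real.sqrt_mul hb.le]
    exact Real.sqrt_le_sqrt hbT
  have hNsq : √n ^ 2 = n := Real.sq_sqrt hn0.le
  have hssq : √T ^ 2 = T := Real.sq_sqrt hT.le
  have hTn : T / n ≤ 1 / a := by
    rw [div_le_div_iff₀ hn0 ha]
    linarith
  have hsb : 0 < √b := Real.sqrt_pos.2 hb
  generalize √n = N at *
  generalize √T = s at *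
  have hN0 : 0 < N := by linarith
  have hsN : 1 / s ≤ √b * (1 / N) := by
    rw [mul_one_div, div_le_div_iff₀ hs0 hN0]
    linarith
  have hx1 : 1 / N ≤ 1 := by rw [div_le_one hN0]; exact hN1
  have hx0 : 0 ≤ 1 / N := by positivity
  -- Each constant is the coefficient of `1 / √n` in one factor: `A` for smoothness and stability,
  -- `B` for the initial distance, `D` for the step-size factor `1 + 2 * L * η`.
  obtain ⟨A, hA⟩ : ∃ A, A = L + 12 * L * (L + 1) * (1 + 1 / a) * c ^ 2 := ⟨_, rfl⟩
  obtain ⟨B, hB⟩ : ∃ B, B = R ^ 2 * √b / (2 * c) := ⟨_, rfl⟩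
  obtain ⟨D, hD⟩ : ∃ D, D = 2 * L * c * √b := ⟨_, rfl⟩
  have hC : rateConstant L c R a b = B + (A + D + A * D) + (A + D + A * D) * B := by
    rw [hA, hB, hD, rateConstant]
  have hA0 : 0 ≤ A := by rw [hA]; positivity
  have hB0 : 0 ≤ B := by rw [hB]; positivity
  have hD0 : 0 ≤ D := by rw [hD]; positivity
  have h1 : 1 + L / N + T * (L + N) * (3 * (n⁻¹ * ((1 + T / n) * (4 * L * (c / s) ^ 2))))
      ≤ 1 + A * (1 / N) := by
    have e : T * (L + N) * (3 * (n⁻¹ * ((1 + T / n) * (4 * L * (c / s) ^ 2))))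
        = 12 * L * ((L + N) / n) * (1 + T / n) * c ^ 2 := by
      rw [div_pow, hssq]
      field_simp
      ring
    have e2 : (L + N) / n ≤ (L + 1) * (1 / N) := by
      rw [mul_one_div, div_le_div_iff₀ hn0 hN0, ← hNsq]
      nlinarith [mul_nonneg (mul_nonneg hL.le hN0.le) (sub_nonneg.2 hN1)]
    have e3 : 12 * L * ((L + N) / n) * (1 + T / n) * c ^ 2
        ≤ 12 * L * ((L + 1) * (1 / N)) * (1 + 1 / a) * c ^ 2 := by gcongr
    have e4 : A * (1 / N) = L / N + 12 * L * ((L + 1) * (1 / N)) * (1 + 1 / a) * c ^ 2 := by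
      rw [hA]
      ring
    rw [e, e4]
    linarith
  have h2 : 1 + 2 * L * (c / s) ≤ 1 + D * (1 / N) := by
    have : 2 * L * c * (1 / s) ≤ 2 * L * c * (√b * (1 / N)) := by gcongr
    have e : 2 * L * (c / s) = 2 * L * c * (1 / s) := by ring
    rw [hD, e]
    linarith
  have h3 : r ^ 2 / (2 * (c / s)) / T + F ≤ B * (1 / N) + F := by
    have e : r ^ 2 / (2 * (c / s)) / T = r ^ 2 / (2 * c) * (1 / s) := by
      rw [← hssq]
      field_simp
    have e2 : B * (1 / N) = R ^ 2 / (2 * c) * (√b * (1 / N)) := by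
      rw [hB]
      ring
    rw [e, e2]
    gcongr
  -- A factor `T` is moved from the last bracket to the first, so that the product takes the shape
  -- treated by `one_add_mul_mul_le`.
  have e : ((1 + L / N) * T⁻¹ + (L + N) * (3 * (n⁻¹ * ((1 + T / n) * (4 * L * (c / s) ^ 2)))))
      * ((1 + 2 * L * (c / s)) * (r ^ 2 / (2 * (c / s)) + T * F))
      = (1 + L / N + T * (L + N) * (3 * (n⁻¹ * ((1 + T / n) * (4 * L * (c / s) ^ 2)))))
      * ((1 + 2 * L * (c / s)) * (r ^ 2 / (2 * (c / s)) / T + F)) := by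
    generalize 3 * (n⁻¹ * ((1 + T / n) * (4 * L * (c / s) ^ 2))) = K
    generalize r ^ 2 / (2 * (c / s)) = Y
    generalize c / s = y
    field_simp
  rw [e, hC, div_eq_mul_one_div (F + 1)]
  refine le_trans ?_ (one_add_mul_mul_le hF hA0 hB0 hD0 hx0 hx1)
  gcongr

variable {d n : ℕ} [NeZero n] {Z : Type*} [MeasurableSpace Z] {L η : ℝ} {Ω : Set (Param d)}
  {f : Param d → Z → ℝ} {ρ : Measure Z} [IsProbabilityMeasure ρ]

theorem sub_le_integral_popRisk_sgdAverage (h : SGDAssumptions L η Ω f ρ) {u : Param d}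
    (hu : u ∈ Ω) (hmin : ∀ w ∈ Ω, popRisk ρ f u ≤ popRisk ρ f w) {T : ℕ} (hT : 0 < T) :
    popRisk ρ f u - (popRisk ρ f u + L * ‖u‖ ^ 2) / T
      ≤ ∫ p, popRisk ρ f (sgdAverage Ω f (fun _ => η) p.1 p.2 T) ∂(sampleIndexLaw ρ n) := by
  have := integral_mono (integrable_const _) (integrable_popRisk_sgdAverage (n := n) h hT)
    fun p => popRisk_sub_le_popRisk_sgdAverage h hu hmin p.1 p.2 hT
  simpa using this

/-- The value `γ = √n` balances `L / γ` against the stability term, of order `γ / n`. The `O(1 / T)`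
loss in the lower bound is absorbed since `√n ≤ n`. -/
theorem abs_integral_popRisk_sub_le_of_step_div_sqrt {c R a b : ℝ} {T : ℕ} (hc : 0 < c)
    (ha : 0 < a) (hb : 0 < b) (h : SGDAssumptions L (c / √(T : ℝ)) Ω f ρ) {u : Param d}
    (hu : u ∈ Ω) (hmin : ∀ w ∈ Ω, popRisk ρ f u ≤ popRisk ρ f w) (hR : ‖u‖ ≤ R) (hT : 0 < T)
    (haT : a * (T : ℝ) ≤ n) (hbT : (n : ℝ) ≤ b * T) :
    |(∫ p, popRisk ρ f (sgdAverage Ω f (fun _ => c / √(T : ℝ)) p.1 p.2 T) ∂(sampleIndexLaw ρ n))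
        - popRisk ρ f u|
      ≤ (rateConstant L c R a b + (1 + L * R ^ 2) * b)
        * ((popRisk ρ f u + 1) / √(n : ℝ)) := by
  have hL := h.smooth_pos
  have hF := popRisk_nonneg h u
  have hn1 : (1 : ℝ) ≤ n := by exact_mod_cast Nat.pos_of_neZero n
  have hT' : (0 : ℝ) < T := by exact_mod_cast hT
  have hR0 : 0 ≤ R := (norm_nonneg u).trans hR
  have hup := (integral_popRisk_sgdAverage_le (n := n) h hu (γ := √(n : ℝ))
    (by positivity) hT).trans (risk_bound_le_rate hL hc ha hb hF (norm_nonneg u) hR hn1 hT' haT hbT)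
  have hlow := sub_le_integral_popRisk_sgdAverage (n := n) h hu hmin hT
  generalize ∫ p, popRisk ρ f (sgdAverage Ω f (fun _ => c / √(T : ℝ)) p.1 p.2 T)
    ∂(sampleIndexLaw ρ n) = E at hup hlow ⊢
  generalize popRisk ρ f u = F at hF hup hlow ⊢
  have hN0 : 0 < √(n : ℝ) := by positivity
  have hLo : (F + L * ‖u‖ ^ 2) / T ≤ (1 + L * R ^ 2) * b * ((F + 1) / √(n : ℝ)) := by
    have e1 : 1 / (T : ℝ) ≤ b * (1 / √(n : ℝ)) := by
      rw [mul_one_div, div_le_div_iff₀ hT' hN0]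
      have : √(n : ℝ) ≤ n := (Real.sqrt_le_left (by linarith)).2 (by nlinarith)
      linarith
    have e2 : F + L * ‖u‖ ^ 2 ≤ (1 + L * R ^ 2) * (F + 1) := by
      have e3 : L * ‖u‖ ^ 2 ≤ L * R ^ 2 := by gcongr
      have e4 : 0 ≤ L * R ^ 2 * F := by positivity
      linarith
    calc (F + L * ‖u‖ ^ 2) / T = (F + L * ‖u‖ ^ 2) * (1 / T) := div_eq_mul_one_div _ _
      _ ≤ (1 + L * R ^ 2) * (F + 1) * (b * (1 / √(n : ℝ))) := by gcongr
      _ = _ := by ring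
  have hC := rateConstant_nonneg (R := R) hL hc ha hb
  have hP1 : 0 ≤ rateConstant L c R a b * ((F + 1) / √(n : ℝ)) := by positivity
  have hP2 : 0 ≤ (1 + L * R ^ 2) * b * ((F + 1) / √(n : ℝ)) := by positivity
  rw [add_mul, abs_le]
  constructor <;> linarith

/-- Zero minimal risk removes the term growing with `T`, so the summed training losses stay bounded
and the prefactor `O(1 / n)` at `γ = 1` is the rate. The lower bound is nonnegativity of the risk.
-/
theorem abs_integral_popRisk_sub_le_of_low_noise {R a b : ℝ} {T : ℕ} (ha : 0 < a)
    (h : SGDAssumptions L η Ω f ρ) {u : Param d}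
    (hu : u ∈ Ω) (h0 : popRisk ρ f u = 0) (hR : ‖u‖ ≤ R) (hT : 0 < T)
    (haT : a * (T : ℝ) ≤ n) (hbT : (n : ℝ) ≤ b * T) :
    |(∫ p, popRisk ρ f (sgdAverage Ω f (fun _ => η) p.1 p.2 T) ∂(sampleIndexLaw ρ n))
        - popRisk ρ f u|
      ≤ ((1 + L) * b + (L + 1) * (3 * ((1 + 1 / a) * (4 * L * η ^ 2))))
        * ((1 + 2 * L * η) * (R ^ 2 / (2 * η))) * (1 / n) := by
  have hL := h.smooth_pos
  have hη := h.step_pos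
  have hn : (0 : ℝ) < n := by exact_mod_cast Nat.pos_of_neZero n
  have hT' : (0 : ℝ) < T := by exact_mod_cast hT
  have hup := integral_popRisk_sgdAverage_le (n := n) h hu one_pos hT
  have hlow : 0 ≤ ∫ p, popRisk ρ f (sgdAverage Ω f (fun _ => η) p.1 p.2 T)
      ∂(sampleIndexLaw ρ n) := integral_nonneg fun p => popRisk_nonneg h _
  rw [h0, mul_zero, add_zero, div_one] at hup
  rw [h0, sub_zero, abs_of_nonneg hlow]
  refine hup.trans ?_
  have hTn : (T : ℝ) / n ≤ 1 / a := by
    rw [div_le_div_iff₀ hn ha]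
    linarith
  have hTb : (T : ℝ)⁻¹ ≤ b * (n : ℝ)⁻¹ := by
    rw [inv_le_iff_one_le_mul₀ hT', mul_right_comm, ← div_eq_mul_inv, one_le_div hn]
    exact hbT
  have e : ((1 + L) * b + (L + 1) * (3 * ((1 + 1 / a) * (4 * L * η ^ 2))))
        * ((1 + 2 * L * η) * (R ^ 2 / (2 * η))) * (1 / n)
      = ((1 + L) * (b * (n : ℝ)⁻¹)
          + (L + 1) * (3 * ((n : ℝ)⁻¹ * ((1 + 1 / a) * (4 * L * η ^ 2)))))
        * ((1 + 2 * L * η) * (R ^ 2 / (2 * η))) := by ring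
  rw [e]
  have hb : 0 ≤ b * (n : ℝ)⁻¹ := le_trans (by positivity) hTb
  gcongr

end Rates

theorem mainTheorem4 :
    -- (a) step sizes `c / √T`
    (∀ L c R a b : ℝ, 0 < L → 0 < c → 0 ≤ R → 0 < a → 0 < b →
      ∃ C : ℝ, ∀ (d : ℕ) (Z : Type*) [MeasurableSpace Z] (ρ : Measure Z) [IsProbabilityMeasure ρ]
        (Ω : Set (Param d)) (f : Param d → Z → ℝ) (wstar : Param d) (n T : ℕ) [NeZero n],
        IsClosed Ω → Convex ℝ Ω →
        (∀ w, Measurable (f w)) → (∀ w, Integrable (f w) ρ) →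
        IsSmoothConvexLoss L f →
        wstar ∈ Ω → (∀ w ∈ Ω, popRisk ρ f wstar ≤ popRisk ρ f w) → ‖wstar‖ ≤ R →
        a * (T : ℝ) ≤ n → (n : ℝ) ≤ b * T →
        c / √(T : ℝ) ≤ 1 / (2 * L) →
        Integrable
          (fun p => popRisk ρ f (sgdAverage Ω f (fun _ => c / √(T : ℝ)) p.1 p.2 T))
          (sampleIndexLaw ρ n) ∧
        |(∫ p, popRisk ρ f (sgdAverage Ω f (fun _ => c / √(T : ℝ)) p.1 p.2 T)
            ∂(sampleIndexLaw ρ n)) - popRisk ρ f wstar|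
          ≤ C * ((popRisk ρ f wstar + 1) / √(n : ℝ))) ∧
    -- (b) constant step size in the low-noise case
    (∀ L η₁ R a b : ℝ, 0 < L → 0 < η₁ → η₁ ≤ 1 / (2 * L) → 0 ≤ R → 0 < a → 0 < b →
      ∃ C : ℝ, ∀ (d : ℕ) (Z : Type*) [MeasurableSpace Z] (ρ : Measure Z) [IsProbabilityMeasure ρ]
        (Ω : Set (Param d)) (f : Param d → Z → ℝ) (wstar : Param d) (n T : ℕ) [NeZero n],
        IsClosed Ω → Convex ℝ Ω →
        (∀ w, Measurable (f w)) → (∀ w, Integrable (f w) ρ) →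
        IsSmoothConvexLoss L f →
        wstar ∈ Ω → (∀ w ∈ Ω, popRisk ρ f wstar ≤ popRisk ρ f w) → ‖wstar‖ ≤ R →
        popRisk ρ f wstar = 0 →
        a * (T : ℝ) ≤ n → (n : ℝ) ≤ b * T →
        Integrable
          (fun p => popRisk ρ f (sgdAverage Ω f (fun _ => η₁) p.1 p.2 T))
          (sampleIndexLaw ρ n) ∧
        |(∫ p, popRisk ρ f (sgdAverage Ω f (fun _ => η₁) p.1 p.2 T)
            ∂(sampleIndexLaw ρ n)) - popRisk ρ f wstar|
          ≤ C * (1 / (n : ℝ))) := by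
  -- Since `n ≥ 1`, the comparison `n ≤ b * T` rules out `T = 0`, where the step `c / √T` would be
  -- `0` by convention.
  have hTpos : ∀ (n T : ℕ) [NeZero n] (b : ℝ), (n : ℝ) ≤ b * T → 0 < T := by
    intro n T _ b hbT
    rcases Nat.eq_zero_or_pos T with rfl | hT
    · have : (0 : ℝ) < n := by exact_mod_cast Nat.pos_of_neZero n
      simp at hbT
      exact absurd hbT (NeZero.ne n)
    · exact hT
  have hstep : ∀ L η : ℝ, 0 < L → η ≤ 1 / (2 * L) → η * L ≤ 1 / 2 := by
    intro L η hL h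
    rw [le_div_iff₀ (by positivity)] at h
    linarith
  constructor
  · intro L c R a b hL hc _ ha hb
    refine ⟨rateConstant L c R a b + (1 + L * R ^ 2) * b,
      fun d Z _ ρ _ Ω f wstar n T _ hcl hcv hm hi hf hw hmin hR haT hbT hη => ?_⟩
    have hT := hTpos n T b hbT
    have h : SGDAssumptions L (c / √(T : ℝ)) Ω f ρ :=
      ⟨hL, by positivity, hstep L _ hL hη, ⟨wstar, hw⟩, hcl, hcv, hm, hi, hf⟩
    exact ⟨integrable_popRisk_sgdAverage h hT, abs_integral_popRisk_sub_le_of_step_div_sqrt hc ha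
      hb h hw hmin hR hT haT hbT⟩
  · intro L η R a b hL hη hηL _ ha _
    refine ⟨((1 + L) * b + (L + 1) * (3 * ((1 + 1 / a) * (4 * L * η ^ 2))))
        * ((1 + 2 * L * η) * (R ^ 2 / (2 * η))),
      fun d Z _ ρ _ Ω f wstar n T _ hcl hcv hm hi hf hw _ hR h0 haT hbT => ?_⟩
    have hT := hTpos n T b hbT
    have h : SGDAssumptions L η Ω f ρ :=
      ⟨hL, hη, hstep L η hL hηL, ⟨wstar, hw⟩, hcl, hcv, hm, hi, hf⟩
    exact ⟨integrable_popRisk_sgdAverage h hT,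
      abs_integral_popRisk_sub_le_of_low_noise ha h hw h0 hR hT haT hbT⟩
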